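/- **Theorem 3.6 (Transmission cost, continuous circle).** Let $N,v,r>0$ and let $S=\mathbb R/N\mathbb Z$ be the circle of circumference $N$. Two walkers $j=1,2$ start from arbitrary positions $X_0(j)\in S$ with arbitrary directions $D_0(j)\in\{+1,-1\}$ ($+1$ is clockwise). Each walker moves at constant speed $v$ in its current direction and reverses its direction at the end of successive holding times; all holding times of both walkers are independent and exponentially distributed with mean $1/r$. Write $X_t(j)$ and $D_t(j)$ for the position and the direction of walker $j$ at time $t\ge 0$, with $t\mapsto D_t(j)$ right-continuous. One of the walkers carries a message, which is initially given to an arbitrary walker; $I_t\in\{1,2\}$ denotes the carrier at time $t$. The path $t\mapsto I_t$ is right-continuous with left limits. At each time $t\geq 0$, if $i$ is the carrier just before $t$ (for $t=0$: the walker initially given the message) and $j$ is the other walker, then $I_t=j$ if $X_t(i)=X_t(j)$, $D_t(i)=-1$ and $D_t(j)=+1$, and $I_t=i$ otherwise. Let $M_t$ be the number of times in $(0,t]$ at which the message jumps from one walker to the other. Then, for every initial state, almost surely such a carrier path exists and, for every such path, $M_t$ is finite for all $t$ and $$\lim_{t\to\infty}\frac{M_t}{t}=c:=\frac{rv}{2v+rN}.$$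 Moreover, there is a constant $s$, the long-term average speed of the message, such that almost surely $$\lim_{t\to\infty}\frac1t\int_0^t v\,D_u(I_u)\,du=s,$$ and $c=\dfrac rv\, s$. -/

import Mathlib

open Set Filter Topology MeasureTheory ProbabilityTheory

noncomputable section

/-- The time of the `n`-th reversal of a walker whose successive holding times are
`τ 0, τ 1, …` (so that `switchTime τ 0 = 0`). -/
def switchTime (τ : ℕ → ℝ) (n : ℕ) : ℝ :=
  ∑ k ∈ Finset.range n, τ k

/-- The number of reversals in the time interval `[0, t]`. -/
def numSwitches (τ : ℕ → ℝ) (t : ℝ) : ℕ :=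
  {n : ℕ | 1 ≤ n ∧ switchTime τ n ≤ t}.ncard

/-- The direction at time `t` (`1` is clockwise, `-1` counter-clockwise) of a walker with
initial direction `d` and holding times `τ`; it is right-continuous in `t`. -/
def direction (d : ℤˣ) (τ : ℕ → ℝ) (t : ℝ) : ℤˣ :=
  d * (-1) ^ numSwitches τ t

/-- The position at time `t`, on the circle `ℝ / Nℤ`, of a walker that starts at `x` with
direction `d` and moves at constant speed `v` in its current direction. -/
def position (N v : ℝ) (x : AddCircle N) (d : ℤˣ) (τ : ℕ → ℝ) (t : ℝ) : AddCircle N :=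
  x + ((v * ∫ s in (0 : ℝ)..t, ((direction d τ s : ℤ) : ℝ) : ℝ) : AddCircle N)

open Classical in
/-- The transmission rule for two walkers with positions `x` and directions `d`: if the carrier `i`
moves counter-clockwise and the other walker `i.rev` is at the same place and moves clockwise, the
message passes to the other walker; otherwise it stays with `i`. -/
def transmit {S : Type*} (x : Fin 2 → S) (d : Fin 2 → ℤˣ) (i : Fin 2) : Fin 2 :=
  if x i = x i.rev ∧ d i = -1 ∧ d i.rev = 1 then i.rev else i

/-- `I : ℝ → Fin 2` (of which only the values at times `t ≥ 0` matter) is a path of the index of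
the message carrier, when the two walkers follow the paths `X` and `D` and the message is
initially given to walker `i`: the path is right-continuous with left limits, and at every time
its value results from the value just before by the transmission rule. -/
structure IsCarrierPath {S : Type*} (X : Fin 2 → ℝ → S) (D : Fin 2 → ℝ → ℤˣ) (i : Fin 2)
    (I : ℝ → Fin 2) : Prop where
  right_cont : ∀ t : ℝ, 0 ≤ t → ∀ᶠ s in 𝓝[>] t, I s = I t
  initial : I 0 = transmit (fun j => X j 0) (fun j => D j 0) i
  step : ∀ t : ℝ, 0 < t → ∃ k : Fin 2, (∀ᶠ s in 𝓝[<] t, I s = k) ∧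
    I t = transmit (fun j => X j t) (fun j => D j t) k

/-- The times in `(0, t]` at which the message jumps from one walker to the other. -/
def jumpTimes (I : ℝ → Fin 2) (t : ℝ) : Set ℝ :=
  {s : ℝ | 0 < s ∧ s ≤ t ∧ ¬ ContinuousAt I s}

end

/-!
Let the *gap* `h` be the clockwise distance from the walker without the message to the carrier,
and let `a`, `b` be the directions of the carrier and of the other walker. The gap moves with
speed `v (a - b)`; when it reaches `N` it wraps around to `0`, and when it reaches `0` from above
there is a handoff: the walkers exchange roles, so that `(a, b) = (-1, 1)` turns into `(1, -1)`.
Each of `a` and `b` changes its sign at rate `r`. An observable `φ(h, a, b)` which is compatible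
with wrapping and which jumps by `β` at each handoff therefore satisfies, along each path
(`TwoWalkers.obs_sub_obs_zero`),
`φ(t) - φ(0) = β M_t + ∫ drift + (sum of the changes of φ at the reversals)`.

For each walker, the sum of the changes at its reversals is, up to `o(t)`, `r` times the integral
of the change that a reversal would cause (`TwoWalkers.ae_tendsto_reversalGain`). To see this,
condition on the whole motion of the *other* walker. During each holding time the change that a
reversal would cause is then a function of the elapsed time alone, given the past; the holding
time is exponential and independent of this function, so that "change at the reversal minus `r`
times the integral" has conditional mean zero, and these differences form an orthogonal sequence
with bounded second moments, which obeys the strong law (`ae_tendsto_reward`). As `φ` is bounded,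
`β M_t` plus the time integral of the generator applied to `φ` is `o(t)`
(`TwoWalkers.tendsto_generator`).

This is applied to two observables. The quadratic function `TwoWalkers.handoffPotential` has
`β = 1` and constant generator `-c` with `c = r v / (2 v + r N)`, which gives `M_t / t → c`. The
direction `a` of the carrier has `β = 2` and generator `-2 r a`, which gives the average speed
`v c / r`.

The carrier path is determined by the motion: the carrier just before `t` is read off from the
last handoff condition met before `t` (`carrierBefore`), as such times are isolated. Since this
functional depends on the motion before `t` only, suppressing the later reversals of one walker
does not affect it, and since handoffs happen at countably many measurably chosen times, it is
jointly measurable in the holding times and in `t` (`TwoWalkers.measurable_carrier`). Of the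
coincidences of probability zero, only simultaneous reversals of both walkers are to be excluded.
-/

/-! ### Exponential holding times -/

lemma lintegral_expMeasure {r : ℝ} {f : ℝ → ENNReal} (hf : Measurable f) :
    ∫⁻ s, f s ∂expMeasure r =
      ∫⁻ s in Ioi 0, ENNReal.ofReal (r * Real.exp (-(r * s))) * f s := by
  have h : expMeasure r = volume.withDensity (exponentialPDF r) := rfl
  rw [h, lintegral_withDensity_eq_lintegral_mul _ (by unfold exponentialPDF; fun_prop) hf,
    ← lintegral_indicator measurableSet_Ioi]
  refine lintegral_congr_ae ?_
  filter_upwards [Measure.ae_ne volume (0 : ℝ)] with s hs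
  rcases lt_or_gt_of_ne hs with h | h
  · simp [exponentialPDF_of_neg h, h.le]
  · simp [exponentialPDF_of_nonneg h.le, h]

lemma ae_pos_expMeasure {r : ℝ} : ∀ᵐ s ∂expMeasure r, 0 < s := by
  have : expMeasure r (Ioi 0)ᶜ = 0 := by
    rw [← lintegral_indicator_one measurableSet_Ioi.compl,
      lintegral_expMeasure (measurable_one.indicator measurableSet_Ioi.compl)]
    refine (setLIntegral_congr_fun measurableSet_Ioi (g := 0) fun s hs => ?_).trans (by simp)
    simp [not_le.2 (mem_Ioi.1 hs)]
  exact this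

lemma expMeasure_singleton {r : ℝ} (a : ℝ) : expMeasure r {a} = 0 := by
  have h : expMeasure r = volume.withDensity (exponentialPDF r) := rfl
  rw [h]
  exact withDensity_absolutelyContinuous _ _ (by simp)

lemma expMeasure_Ici {r : ℝ} (hr : 0 < r) {t : ℝ} (ht : 0 ≤ t) :
    expMeasure r (Ici t) = ENNReal.ofReal (Real.exp (-(r * t))) := by
  have := isProbabilityMeasure_expMeasure hr
  have h1 : expMeasure r (Ici t) = expMeasure r (Ioi t) := by
    rw [← Ioi_union_left, measure_union (by simp) (by simp), expMeasure_singleton, add_zero]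
  rw [h1, ← compl_Iic, prob_compl_eq_one_sub measurableSet_Iic]
  have h2 := cdf_expMeasure_eq hr t
  rw [if_pos ht, cdf_eq_real, measureReal_def] at h2
  rw [← ENNReal.ofReal_toReal (measure_ne_top (expMeasure r) (Iic t)), h2, ← ENNReal.ofReal_one,
    ← ENNReal.ofReal_sub _ (by simpa using by positivity)]
  congr 1
  ring

lemma memLp_id_expMeasure {r : ℝ} (hr : 0 < r) : MemLp id 2 (expMeasure r) := by
  rw [memLp_two_iff_integrable_sq measurable_id.aestronglyMeasurable]
  refine ⟨by fun_prop, ?_⟩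
  rw [hasFiniteIntegral_iff_enorm, lintegral_expMeasure (by fun_prop)]
  have h := (integrableOn_rpow_mul_exp_neg_mul_rpow (p := 1) (s := 2) (b := r)
    (by norm_num) one_pos hr).const_mul r
  have h2 := h.2
  rw [hasFiniteIntegral_iff_enorm] at h2
  refine lt_of_eq_of_lt (setLIntegral_congr_fun measurableSet_Ioi fun s hs => ?_) h2
  have hs' : (0 : ℝ) < s := hs
  simp only [Real.rpow_one, Real.rpow_ofNat, id]
  rw [Real.enorm_eq_ofReal (by positivity), Real.enorm_eq_ofReal (by positivity),
    ← ENNReal.ofReal_mul (by positivity)]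
  congr 1
  rw [neg_mul]; ring

lemma abs_intervalIntegral_le {g : ℝ → ℝ} {C : ℝ} (hg : ∀ s, |g s| ≤ C) (a b : ℝ) :
    |∫ u in a..b, g u| ≤ C * |b - a| := by
  simpa using intervalIntegral.norm_integral_le_of_norm_le_const (a := a) (b := b) (f := g)
    (C := C) fun x _ => hg x

lemma intervalIntegrable_of_bounded {g : ℝ → ℝ} {C : ℝ} (hm : Measurable g) (hg : ∀ s, |g s| ≤ C)
    (a b : ℝ) : IntervalIntegrable g volume a b := by
  rw [intervalIntegrable_iff]
  exact Measure.integrableOn_of_bounded (M := C) (by simp) hm.aestronglyMeasurable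
    (Eventually.of_forall hg)

lemma measurable_intervalIntegral_zero {g : ℝ → ℝ} {C : ℝ} (hm : Measurable g)
    (hg : ∀ s, |g s| ≤ C) : Measurable fun s => ∫ u in (0 : ℝ)..s, g u :=
  (intervalIntegral.continuous_primitive
    (fun a b => intervalIntegrable_of_bounded hm hg a b) 0).measurable

lemma integrable_integral_expMeasure {r : ℝ} (hr : 0 < r) {g : ℝ → ℝ} {C : ℝ} (hm : Measurable g)
    (hg : ∀ s, |g s| ≤ C) : Integrable (fun s => ∫ u in (0 : ℝ)..s, g u) (expMeasure r) := by
  have := isProbabilityMeasure_expMeasure hr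
  have h1 : Integrable (fun s : ℝ => C * s) (expMeasure r) :=
    ((memLp_id_expMeasure hr).integrable one_le_two).const_mul C
  refine h1.mono (measurable_intervalIntegral_zero hm hg).aestronglyMeasurable
    (Eventually.of_forall fun s => ?_)
  have h2 : |∫ u in (0 : ℝ)..s, g u| ≤ C * |s - 0| := abs_intervalIntegral_le hg _ _
  have h0 : 0 ≤ C := (abs_nonneg _).trans (hg 0)
  simpa [abs_mul, abs_of_nonneg h0] using h2

lemma integral_expMeasure_of_nonneg {r : ℝ} (hr : 0 < r) {g : ℝ → ℝ} {C : ℝ} (hm : Measurable g)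
    (h0 : ∀ s, 0 ≤ g s) (hg : ∀ s, |g s| ≤ C) :
    ∫ s, g s ∂expMeasure r = r * ∫ s, (∫ u in (0 : ℝ)..s, g u) ∂expMeasure r := by
  have := isProbabilityMeasure_expMeasure hr
  have hmI := measurable_intervalIntegral_zero hm hg
  have hpos : 0 ≤ᵐ[expMeasure r] fun s : ℝ => ∫ u in (0 : ℝ)..s, g u :=
    ae_pos_expMeasure.mono fun s hs =>
      intervalIntegral.integral_nonneg hs.le fun u _ => h0 u
  have key := lintegral_comp_eq_lintegral_meas_le_mul (expMeasure r) (f := fun s : ℝ => s)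
    (ae_pos_expMeasure.mono fun s hs => hs.le) aemeasurable_id
    (fun t _ => intervalIntegrable_of_bounded hm hg 0 t) (Eventually.of_forall h0)
  rw [integral_eq_lintegral_of_nonneg_ae (Eventually.of_forall h0) hm.aestronglyMeasurable,
    integral_eq_lintegral_of_nonneg_ae hpos hmI.aestronglyMeasurable, key]
  have h1 : r = (ENNReal.ofReal r).toReal := (ENNReal.toReal_ofReal hr.le).symm
  nth_rw 2 [h1]
  rw [← ENNReal.toReal_mul, lintegral_expMeasure (by fun_prop),
    ← lintegral_const_mul' _ _ (by simp)]
  congr 1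
  refine setLIntegral_congr_fun measurableSet_Ioi fun s hs => ?_
  have : {a : ℝ | s ≤ a} = Ici s := rfl
  simp only [this]
  rw [expMeasure_Ici hr (le_of_lt hs), ENNReal.ofReal_mul hr.le, mul_assoc]

/-- The infinitesimal lack of memory of the exponential law: a clock of rate `r` that rings at
time `s` collects on average the same reward `g s` as the running reward `r * g` up to `s`. -/
lemma integral_sub_integral_expMeasure {r : ℝ} (hr : 0 < r) {g : ℝ → ℝ} {C : ℝ}
    (hm : Measurable g) (hg : ∀ s, |g s| ≤ C) :
    ∫ s, (g s - r * ∫ u in (0 : ℝ)..s, g u) ∂expMeasure r = 0 := by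
  have := isProbabilityMeasure_expMeasure hr
  have hC : 0 ≤ C := (abs_nonneg _).trans (hg 0)
  have hint : ∀ {f : ℝ → ℝ} {K : ℝ}, Measurable f → (∀ s, |f s| ≤ K) →
      Integrable f (expMeasure r) := fun hf hK =>
    Integrable.of_bound hf.aestronglyMeasurable _ (Eventually.of_forall hK)
  have e1 := integral_expMeasure_of_nonneg hr (g := fun s => g s + C) (C := C + C)
    (by fun_prop) (fun s => by linarith [neg_abs_le (g s), hg s])
    (fun s => (abs_add_le _ _).trans (by rw [abs_of_nonneg hC]; linarith [hg s]))
  have e2 := integral_expMeasure_of_nonneg hr (g := fun _ => C) (C := C)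
    measurable_const (fun _ => hC) (fun _ => (abs_of_nonneg hC).le)
  have e3 : ∀ s, ∫ u in (0 : ℝ)..s, (g u + C) = (∫ u in (0 : ℝ)..s, g u) + ∫ u in (0 : ℝ)..s, C :=
    fun s => intervalIntegral.integral_add (intervalIntegrable_of_bounded hm hg _ _) (by simp)
  have i1 := integrable_integral_expMeasure hr hm hg
  have i2 := integrable_integral_expMeasure hr (g := fun _ => C) measurable_const
    (fun _ => (abs_of_nonneg hC).le)
  simp only [e3] at e1
  rw [integral_add (hint hm hg) (integrable_const C), integral_add i1 i2] at e1
  rw [integral_sub (hint hm hg) (i1.const_mul r), integral_const_mul]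
  linarith

/-! ### A law of large numbers for orthogonal increments -/

/-- Chebyshev and Borel–Cantelli along the squares: orthogonal variables with bounded second
moments obey the strong law along the subsequence `n ^ 2`. -/
lemma ae_tendsto_sum_sq_div {Ω : Type*} [MeasurableSpace Ω] {P : Measure Ω}
    {ξ : ℕ → Ω → ℝ} {K : ℝ} (hL : ∀ n, MemLp (ξ n) 2 P)
    (horth : ∀ k l, k < l → ∫ ω, ξ k ω * ξ l ω ∂P = 0) (hK : ∀ n, ∫ ω, ξ n ω ^ 2 ∂P ≤ K) :
    ∀ᵐ ω ∂P, Tendsto (fun n : ℕ => (∑ k ∈ Finset.range (n ^ 2), ξ k ω) / ((n ^ 2 : ℕ) : ℝ))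
      atTop (𝓝 0) := by
  have hS : ∀ n, MemLp (fun ω => ∑ k ∈ Finset.range n, ξ k ω) 2 P := fun n =>
    memLp_finsetSum _ fun k _ => hL k
  have hK0 : 0 ≤ K := (integral_nonneg fun ω => sq_nonneg _).trans (hK 0)
  have hvar : ∀ n : ℕ, ∫ ω, (∑ k ∈ Finset.range n, ξ k ω) ^ 2 ∂P ≤ n * K := by
    intro n
    induction n with
    | zero => simp
    | succ n ih =>
      have e : ∀ ω, (∑ k ∈ Finset.range (n + 1), ξ k ω) ^ 2 =
          (∑ k ∈ Finset.range n, ξ k ω) ^ 2 + 2 * (∑ k ∈ Finset.range n, ξ k ω * ξ n ω)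
            + ξ n ω ^ 2 := fun ω => by
        rw [Finset.sum_range_succ, ← Finset.sum_mul]; ring
      have im : ∀ k, Integrable (fun ω => ξ k ω * ξ n ω) P := fun k =>
        (hL k).integrable_mul (hL n)
      have ic : Integrable (fun ω => ∑ k ∈ Finset.range n, ξ k ω * ξ n ω) P :=
        integrable_finsetSum _ fun k _ => im k
      have i2 : Integrable (fun ω => (∑ k ∈ Finset.range n, ξ k ω) ^ 2 +
          2 * ∑ k ∈ Finset.range n, ξ k ω * ξ n ω) P := (hS n).integrable_sq.add (ic.const_mul 2)
      simp only [e]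
      rw [integral_add i2 (hL n).integrable_sq,
        integral_add (hS n).integrable_sq (ic.const_mul 2), integral_const_mul,
        integral_finsetSum _ fun k _ => im k,
        Finset.sum_eq_zero fun k hk => horth k n (Finset.mem_range.1 hk)]
      push_cast
      linarith [hK n]
  set X : ℕ → Ω → ℝ := fun n ω => (∑ k ∈ Finset.range (n ^ 2), ξ k ω) / ((n ^ 2 : ℕ) : ℝ) with hX
  have hXL : ∀ n, MemLp (X n) 2 P := fun n => by
    simp only [hX, div_eq_mul_inv]
    exact (hS (n ^ 2)).mul_const _
  have hXv : ∀ n, ∫⁻ ω, ENNReal.ofReal (X n ω ^ 2) ∂P ≤ ENNReal.ofReal (K / n ^ 2) := by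
    intro n
    rw [← ofReal_integral_eq_lintegral_ofReal (hXL n).integrable_sq
      (Eventually.of_forall fun ω => sq_nonneg _)]
    refine ENNReal.ofReal_le_ofReal ?_
    simp only [hX, div_pow]
    rw [integral_div]
    rcases Nat.eq_zero_or_pos n with rfl | hn
    · simp
    have hn' : (0 : ℝ) < n := by exact_mod_cast hn
    rw [div_le_div_iff₀ (by positivity) (by positivity)]
    have := hvar (n ^ 2)
    push_cast at this ⊢
    nlinarith [this, sq_nonneg ((n : ℝ))]
  have hsum : ∑' n, ∫⁻ ω, ENNReal.ofReal (X n ω ^ 2) ∂P ≠ ⊤ := by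
    refine ne_top_of_le_ne_top ?_ (ENNReal.tsum_le_tsum hXv)
    refine Summable.tsum_ofReal_ne_top ?_
    simpa [div_eq_mul_inv] using (Real.summable_nat_pow_inv.2 one_lt_two).mul_left K
  rw [← lintegral_tsum fun n => by
    exact ((hXL n).aestronglyMeasurable.aemeasurable.pow_const 2).ennreal_ofReal] at hsum
  have hae := ae_lt_top' (AEMeasurable.tsum fun n =>
    ((hXL n).aestronglyMeasurable.aemeasurable.pow_const 2).ennreal_ofReal) hsum
  filter_upwards [hae] with ω hω
  have h0 := ENNReal.tendsto_atTop_zero_of_tsum_ne_top hω.ne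
  have h1 : Tendsto (fun n => X n ω ^ 2) atTop (𝓝 0) := by
    have := (ENNReal.tendsto_toReal ENNReal.zero_ne_top).comp h0
    simpa [Function.comp_def, ENNReal.toReal_ofReal (sq_nonneg _)] using this
  have h2 := h1.sqrt
  simp only [Real.sqrt_sq_eq_abs, Real.sqrt_zero] at h2
  exact (tendsto_zero_iff_abs_tendsto_zero _).2 h2

/-- Interpolation between the squares: if the increments are dominated by nonnegative ones whose
averages converge, convergence of the averages along the squares is enough. -/
lemma tendsto_sum_div_of_sq {a b : ℕ → ℝ} {L : ℝ} (hab : ∀ k, |a k| ≤ b k)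
    (hb : Tendsto (fun n : ℕ => (∑ k ∈ Finset.range n, b k) / n) atTop (𝓝 L))
    (ha : Tendsto (fun n : ℕ => (∑ k ∈ Finset.range (n ^ 2), a k) / ((n ^ 2 : ℕ) : ℝ))
      atTop (𝓝 0)) :
    Tendsto (fun n : ℕ => (∑ k ∈ Finset.range n, a k) / n) atTop (𝓝 0) := by
  have hsq : Tendsto (fun n : ℕ => n ^ 2) atTop atTop := tendsto_pow_atTop two_ne_zero
  have hmono : Monotone fun n : ℕ => ∑ k ∈ Finset.range n, (a k + b k) :=
    monotone_nat_of_le_succ fun n => by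
      rw [Finset.sum_range_succ]; linarith [neg_abs_le (a n), hab n]
  have h := tendsto_div_of_monotone_of_exists_subseq_tendsto_div _ L hmono fun c hc => by
    refine ⟨fun n => n ^ 2, ?_, hsq, ?_⟩
    · have hlim : Tendsto (fun n : ℕ => (1 + 1 / (n : ℝ)) ^ 2) atTop (𝓝 1) := by
        simpa using (tendsto_one_div_atTop_nhds_zero_nat.const_add (1 : ℝ)).pow 2
      filter_upwards [(tendsto_order.1 hlim).2 c hc, eventually_gt_atTop 0] with n hn hn0
      have hn' : (0 : ℝ) < n := by exact_mod_cast hn0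
      have e : (((n + 1) ^ 2 : ℕ) : ℝ) = (1 + 1 / (n : ℝ)) ^ 2 * ((n ^ 2 : ℕ) : ℝ) := by
        push_cast; field_simp
      rw [e]
      gcongr
    · have := ha.add (hb.comp hsq)
      simpa [Function.comp_def, Finset.sum_add_distrib, add_div] using this
  have := h.sub hb
  simpa [Finset.sum_add_distrib, add_div] using this

/-! ### The clock of one walker, given the other walker -/

/-- The family `y` of holding times, with all holding times of walker `j` from the `l`-th on
replaced by `s`. With `s = 0` it retains what is known when walker `j` starts its `l`-th holding
time and the whole motion of the other walker is given. -/
def override (j : Fin 2) (l : ℕ) (y : Fin 2 × ℕ → ℝ) (s : ℝ) : Fin 2 × ℕ → ℝ :=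
  fun p => if p.1 = j ∧ l ≤ p.2 then s else y p

lemma override_override {j : Fin 2} {l m : ℕ} (hlm : l ≤ m) (y : Fin 2 × ℕ → ℝ) (s s' : ℝ) :
    override j l (override j m y s) s' = override j l y s' := by
  funext p
  simp only [override]
  grind

lemma measurable_override (j : Fin 2) (l : ℕ) :
    Measurable fun q : (Fin 2 × ℕ → ℝ) × ℝ => override j l q.1 q.2 := by
  refine measurable_pi_lambda _ fun p => ?_
  by_cases h : p.1 = j ∧ l ≤ p.2
  · simpa [override, h] using measurable_snd
  · simp only [override, h, if_false]
    exact (measurable_pi_apply p).comp measurable_fst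

section

variable {Ω : Type*} [MeasurableSpace Ω] {P : Measure Ω} {Y : Ω → Fin 2 × ℕ → ℝ}

lemma indepFun_override (hY : Measurable Y) (hindep : iIndepFun (fun p ω => Y ω p) P)
    (j : Fin 2) (l : ℕ) :
    IndepFun (fun ω => override j l (Y ω) 0) (fun ω => Y ω (j, l)) P := by
  have hm : ∀ p, Measurable fun ω => Y ω p := fun p => (measurable_pi_apply p).comp hY
  have h := indep_iSup_of_disjoint (fun p => (hm p).comap_le) hindep.iIndep
    (disjoint_compl_left (a := ({(j, l)} : Set (Fin 2 × ℕ))))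
  refine indep_of_indep_of_le_right (indep_of_indep_of_le_left h ?_) ?_
  · rw [← measurable_iff_comap_le]
    refine @measurable_pi_lambda _ _ _ (_) _ _ fun p => ?_
    by_cases hp : p.1 = j ∧ l ≤ p.2
    · simp [override, hp]
    · simp only [override, hp, if_false]
      have hne : p ∈ ({(j, l)} : Set (Fin 2 × ℕ))ᶜ := by
        rintro rfl; simp at hp
      exact measurable_iff_comap_le.2 (le_iSup₂_of_le p hne le_rfl)
  · exact le_iSup₂_of_le (j, l) rfl le_rfl

lemma measurable_primitive {h : (Fin 2 × ℕ → ℝ) → ℝ → ℝ} (hm : Measurable (Function.uncurry h)) :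
    Measurable fun q : (Fin 2 × ℕ → ℝ) × ℝ => ∫ u in (0 : ℝ)..q.2, h q.1 u := by
  have e : ∀ q : (Fin 2 × ℕ → ℝ) × ℝ, ∫ u in (0 : ℝ)..q.2, h q.1 u =
      (∫ u, (Ioc 0 q.2).indicator (h q.1) u) - ∫ u, (Ioc q.2 0).indicator (h q.1) u := fun q => by
    rw [integral_indicator measurableSet_Ioc, integral_indicator measurableSet_Ioc]; rfl
  simp only [e]
  have hm' : Measurable fun z : ((Fin 2 × ℕ → ℝ) × ℝ) × ℝ => h z.1.1 z.2 :=
    hm.comp ((measurable_fst.comp measurable_fst).prodMk measurable_snd)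
  refine Measurable.sub ?_ ?_
  · refine (StronglyMeasurable.integral_prod_right' (f := fun z : ((Fin 2 × ℕ → ℝ) × ℝ) × ℝ =>
      (Ioc 0 z.1.2).indicator (h z.1.1) z.2) (Measurable.stronglyMeasurable ?_)).measurable
    exact hm'.indicator ((measurableSet_lt measurable_const measurable_snd).inter
      (measurableSet_le measurable_snd (measurable_snd.comp measurable_fst)))
  · refine (StronglyMeasurable.integral_prod_right' (f := fun z : ((Fin 2 × ℕ → ℝ) × ℝ) × ℝ =>
      (Ioc z.1.2 0).indicator (h z.1.1) z.2) (Measurable.stronglyMeasurable ?_)).measurable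
    exact hm'.indicator ((measurableSet_lt (measurable_snd.comp measurable_fst)
      measurable_snd).inter (measurableSet_le measurable_snd measurable_const))

/-- The averages of the holding times of a walker converge to the mean `1 / r`. -/
lemma ae_tendsto_holding (hY : Measurable Y) (hindep : iIndepFun (fun p ω => Y ω p) P) {r : ℝ}
    (hr : 0 < r) (hlaw : ∀ p, P.map (fun ω => Y ω p) = expMeasure r) (j : Fin 2) :
    ∀ᵐ ω ∂P, Tendsto (fun n : ℕ => (∑ l ∈ Finset.range n, Y ω (j, l)) / n) atTop (𝓝 (1 / r)) := by
  have := isProbabilityMeasure_expMeasure hr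
  have hm : ∀ p, Measurable fun ω => Y ω p := fun p => (measurable_pi_apply p).comp hY
  have hid : ∀ p, Integrable (fun ω => Y ω p) P := fun p => by
    have := (memLp_id_expMeasure hr).integrable one_le_two
    rw [← hlaw p] at this
    exact (integrable_map_measure measurable_id.aestronglyMeasurable (hm p).aemeasurable).1 this
  have h := strong_law_ae_real (fun l ω => Y ω (j, l)) (hid _)
    (fun k l hkl => hindep.indepFun (by simpa using hkl))
    (fun l => ⟨(hm _).aemeasurable, (hm _).aemeasurable, by rw [hlaw, hlaw]⟩)
  have hmean : ∫ ω, Y ω (j, 0) ∂P = 1 / r := by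
    have h1 := integral_sub_integral_expMeasure hr (g := fun _ => 1) (C := 1) measurable_const
      (by simp)
    simp only [intervalIntegral.integral_const, sub_zero, smul_eq_mul, mul_one] at h1
    have hi : Integrable (fun s : ℝ => r * s) (expMeasure r) :=
      ((memLp_id_expMeasure hr).integrable one_le_two).const_mul r
    rw [integral_sub (integrable_const 1) hi, integral_const_mul, integral_const] at h1
    have e : ∫ s, s ∂expMeasure r = ∫ ω, Y ω (j, 0) ∂P := by
      rw [← hlaw (j, 0), integral_map (hm _).aemeasurable (by fun_prop)]
    rw [e, probReal_univ, one_smul] at h1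
    field_simp
    linarith
  simpa [hmean] using h

variable [IsProbabilityMeasure P]

lemma map_override_prodMk (hY : Measurable Y) (hindep : iIndepFun (fun p ω => Y ω p) P) {r : ℝ}
    (hlaw : ∀ p, P.map (fun ω => Y ω p) = expMeasure r) (j : Fin 2) (l : ℕ) :
    P.map (fun ω => (override j l (Y ω) 0, Y ω (j, l))) =
      (P.map fun ω => override j l (Y ω) 0).prod (expMeasure r) := by
  have hm : Measurable fun ω => override j l (Y ω) 0 :=
    (measurable_override j l).comp (hY.prodMk measurable_const)
  have hm2 : Measurable fun ω => Y ω (j, l) := (measurable_pi_apply (j, l)).comp hY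
  rw [(indepFun_iff_map_prod_eq_prod_map_map hm.aemeasurable hm2.aemeasurable).1
    (indepFun_override hY hindep j l), hlaw (j, l)]

/-- The holding time `(j, l)` almost surely misses any value computed from the motion of the other
walker and the earlier holding times of walker `j`. -/
lemma ae_ne_of_override (hY : Measurable Y) (hindep : iIndepFun (fun p ω => Y ω p) P) {r : ℝ}
    (hr : 0 < r) (hlaw : ∀ p, P.map (fun ω => Y ω p) = expMeasure r) (j : Fin 2) (l : ℕ)
    {g : (Fin 2 × ℕ → ℝ) → ℝ} (hg : Measurable g) (hpast : ∀ y, g (override j l y 0) = g y) :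
    ∀ᵐ ω ∂P, Y ω (j, l) ≠ g (Y ω) := by
  have := isProbabilityMeasure_expMeasure hr
  have hm : Measurable fun ω => override j l (Y ω) 0 :=
    (measurable_override j l).comp (hY.prodMk measurable_const)
  have h : ∀ᵐ q ∂(P.map fun ω => override j l (Y ω) 0).prod (expMeasure r), q.2 ≠ g q.1 := by
    refine (Measure.ae_prod_iff_ae_ae
      (measurableSet_eq_fun measurable_snd (hg.comp measurable_fst)).compl).2 ?_
    refine Eventually.of_forall fun y => ?_
    have : expMeasure r {g y} = 0 := expMeasure_singleton _
    exact measure_eq_zero_iff_ae_notMem.1 this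
  rw [← map_override_prodMk hY hindep hlaw] at h
  have h2 := ae_of_ae_map (hm.prodMk ((measurable_pi_apply (j, l)).comp hY)).aemeasurable h
  simpa [hpast] using h2

/-- Strong law of large numbers for the rewards collected at the reversals of walker `j`. The
reward rate `h l` during the `l`-th holding time may depend on the earlier holding times of walker
`j` and on the whole motion of the other walker; since the clock of walker `j` is independent of
these, the collected reward minus the running reward is an orthogonal sequence. -/
lemma ae_tendsto_reward (hY : Measurable Y) (hindep : iIndepFun (fun p ω => Y ω p) P) {r : ℝ}
    (hr : 0 < r) (hlaw : ∀ p, P.map (fun ω => Y ω p) = expMeasure r) (j : Fin 2)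
    {h : ℕ → (Fin 2 × ℕ → ℝ) → ℝ → ℝ} (hm : ∀ l, Measurable (Function.uncurry (h l))) {C : ℝ}
    (hC : ∀ l y s, |h l y s| ≤ C) (hpast : ∀ l y s, h l (override j l y 0) s = h l y s) :
    ∀ᵐ ω ∂P, Tendsto (fun n : ℕ => (∑ l ∈ Finset.range n,
      (h l (Y ω) (Y ω (j, l)) - r * ∫ u in (0 : ℝ)..Y ω (j, l), h l (Y ω) u)) / n)
      atTop (𝓝 0) := by
  have := isProbabilityMeasure_expMeasure hr
  have hC0 : 0 ≤ C := (abs_nonneg _).trans (hC 0 0 0)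
  have hmY : ∀ p, Measurable fun ω => Y ω p := fun p => (measurable_pi_apply p).comp hY
  set Ψ : ℕ → (Fin 2 × ℕ → ℝ) → ℝ → ℝ :=
    fun l y s => h l y s - r * ∫ u in (0 : ℝ)..s, h l y u with hΨ
  have hΨm : ∀ l, Measurable fun q : (Fin 2 × ℕ → ℝ) × ℝ => Ψ l q.1 q.2 := fun l =>
    (hm l).sub ((measurable_primitive (hm l)).const_mul r)
  have hΨpast : ∀ k l y s, k ≤ l → Ψ k (override j l y 0) s = Ψ k y s := by
    intro k l y s hkl
    have e : ∀ u, h k (override j l y 0) u = h k y u := fun u => by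
      rw [← hpast k (override j l y 0), override_override hkl, hpast]
    simp only [hΨ, e]
  have hsec : ∀ l y, Measurable (h l y) := fun l y => (hm l).comp measurable_prodMk_left
  have hbound : ∀ l y s, |Ψ l y s| ≤ C + r * C * |s| := by
    intro l y s
    have := abs_intervalIntegral_le (hC l y) 0 s
    rw [sub_zero] at this
    calc |Ψ l y s| ≤ |h l y s| + |r * ∫ u in (0 : ℝ)..s, h l y u| := abs_sub _ _
      _ ≤ C + r * (C * |s|) := by
          rw [abs_mul, abs_of_pos hr]
          gcongr
          exact hC l y s
      _ = _ := by ring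
  have hdom : ∀ p, MemLp (fun ω => C + r * C * |Y ω p|) 2 P := by
    intro p
    have h1 : MemLp (fun ω => Y ω p) 2 P := by
      have := memLp_id_expMeasure hr
      rw [← hlaw p, memLp_map_measure_iff measurable_id.aestronglyMeasurable
        (hmY p).aemeasurable] at this
      exact this
    exact (memLp_const C).add (h1.norm.const_mul (r * C))
  have hξm : ∀ l, Measurable fun ω => Ψ l (Y ω) (Y ω (j, l)) := fun l =>
    (hΨm l).comp (hY.prodMk (hmY _))
  have hL : ∀ l, MemLp (fun ω => Ψ l (Y ω) (Y ω (j, l))) 2 P := fun l =>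
    (hdom (j, l)).of_le (hξm l).aestronglyMeasurable (Eventually.of_forall fun ω => by
      rw [Real.norm_eq_abs, Real.norm_eq_abs]
      exact (hbound _ _ _).trans (le_abs_self _))
  have hK : ∀ l, ∫ ω, Ψ l (Y ω) (Y ω (j, l)) ^ 2 ∂P ≤
      ∫ s, (C + r * C * |s|) ^ 2 ∂expMeasure r := by
    intro l
    rw [← hlaw (j, l), integral_map (hmY _).aemeasurable (by fun_prop)]
    refine integral_mono (hL l).integrable_sq (hdom _).integrable_sq fun ω => ?_
    exact sq_le_sq.2 ((hbound _ _ _).trans (le_abs_self _))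
  -- the earlier increment is a function of `override j l (Y ω) 0`
  have horth : ∀ k l, k < l →
      ∫ ω, Ψ k (Y ω) (Y ω (j, k)) * Ψ l (Y ω) (Y ω (j, l)) ∂P = 0 := by
    intro k l hkl
    set G : (Fin 2 × ℕ → ℝ) × ℝ → ℝ := fun q => Ψ k q.1 (q.1 (j, k)) * Ψ l q.1 q.2 with hG
    have hGm : Measurable G := by
      have hk : Measurable fun q : (Fin 2 × ℕ → ℝ) × ℝ => (q.1, q.1 (j, k)) :=
        measurable_fst.prodMk ((measurable_pi_apply (j, k)).comp measurable_fst)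
      exact ((hΨm k).comp hk).mul (hΨm l)
    have hpair : Measurable fun ω => (override j l (Y ω) 0, Y ω (j, l)) :=
      ((measurable_override j l).comp (hY.prodMk measurable_const)).prodMk (hmY _)
    have e : ∀ ω, Ψ k (Y ω) (Y ω (j, k)) * Ψ l (Y ω) (Y ω (j, l)) =
        G (override j l (Y ω) 0, Y ω (j, l)) := fun ω => by
      have hk : override j l (Y ω) 0 (j, k) = Y ω (j, k) := by
        simp [override, not_le.2 hkl]
      simp only [hG, hk, hΨpast k l _ _ hkl.le, hΨpast l l _ _ le_rfl]
    have hint : Integrable G (P.map fun ω => (override j l (Y ω) 0, Y ω (j, l))) := by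
      rw [integrable_map_measure hGm.aestronglyMeasurable hpair.aemeasurable]
      refine ((hL k).integrable_mul (hL l)).congr (Eventually.of_forall fun ω => ?_)
      exact e ω
    simp only [e]
    rw [← integral_map hpair.aemeasurable hGm.aestronglyMeasurable]
    rw [map_override_prodMk hY hindep hlaw] at hint ⊢
    rw [integral_prod _ hint]
    -- integrating over the independent holding time `(j, l)` alone already gives `0`
    refine integral_eq_zero_of_ae (Eventually.of_forall fun y => ?_)
    simp only [hG, hΨ, Pi.zero_apply]
    rw [integral_const_mul, integral_sub_integral_expMeasure hr (hsec l y) (hC l y), mul_zero]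
  have hpos : ∀ᵐ ω ∂P, ∀ l, 0 < Y ω (j, l) := ae_all_iff.2 fun l => by
    have := ae_pos_expMeasure (r := r)
    rw [← hlaw (j, l)] at this
    exact ae_of_ae_map (hmY _).aemeasurable this
  filter_upwards [ae_tendsto_sum_sq_div hL horth hK, ae_tendsto_holding hY hindep hr hlaw j, hpos]
    with ω h1 h2 h3
  refine tendsto_sum_div_of_sq (b := fun l => C + r * C * Y ω (j, l)) (L := C + r * C * (1 / r))
    (fun l => ?_) ?_ h1
  · simpa [abs_of_pos (h3 l)] using hbound l (Y ω) (Y ω (j, l))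
  · refine ((h2.const_mul (r * C)).const_add C).congr' ?_
    filter_upwards [eventually_gt_atTop 0] with n hn
    have hn' : (0 : ℝ) < n := by exact_mod_cast hn
    rw [Finset.sum_add_distrib, ← Finset.mul_sum]
    simp only [Finset.sum_const, Finset.card_range, nsmul_eq_mul]
    field_simp

end

/-! ### Reversal times of a single walker -/

/-- The holding times `τ` are positive and there are finitely many reversals in bounded time. -/
structure IsClock (τ : ℕ → ℝ) : Prop where
  pos : ∀ n, 0 < τ n
  tendsto : Tendsto (switchTime τ) atTop atTop

lemma switchTime_succ (τ : ℕ → ℝ) (n : ℕ) : switchTime τ (n + 1) = switchTime τ n + τ n :=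
  Finset.sum_range_succ _ _

lemma switchTime_zero (τ : ℕ → ℝ) : switchTime τ 0 = 0 := rfl

namespace IsClock

variable {τ : ℕ → ℝ} (h : IsClock τ)
include h

lemma strictMono : StrictMono (switchTime τ) :=
  strictMono_nat_of_lt_succ fun n => by rw [switchTime_succ]; linarith [h.pos n]

lemma switchTime_nonneg (n : ℕ) : 0 ≤ switchTime τ n := by
  simpa [switchTime_zero] using h.strictMono.monotone (Nat.zero_le n)

lemma numSwitches_of_mem {m : ℕ} {t : ℝ} (h1 : switchTime τ m ≤ t) (h2 : t < switchTime τ (m + 1)) :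
    numSwitches τ t = m := by
  have e : {n : ℕ | 1 ≤ n ∧ switchTime τ n ≤ t} = (Finset.Icc 1 m : Finset ℕ) := by
    ext n
    simp only [mem_ofPred_eq, Finset.coe_Icc, mem_Icc, and_congr_right_iff]
    intro _
    refine ⟨fun hn => ?_, fun hn => (h.strictMono.monotone hn).trans h1⟩
    exact Nat.lt_succ_iff.1 (h.strictMono.lt_iff_lt.1 (hn.trans_lt h2))
  rw [numSwitches, e, Set.ncard_coe_finset, Nat.card_Icc, Nat.add_sub_cancel]

lemma exists_mem_Ico {t : ℝ} (ht : 0 ≤ t) :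
    ∃ m, switchTime τ m ≤ t ∧ t < switchTime τ (m + 1) := by
  have hex : ∃ n, t < switchTime τ n := (h.tendsto.eventually_gt_atTop t).exists
  classical
  obtain ⟨m, hm⟩ := Nat.exists_eq_succ_of_ne_zero (n := Nat.find hex) fun h0 => by
    have := Nat.find_spec hex
    rw [h0, switchTime_zero] at this
    linarith
  refine ⟨m, not_lt.1 (Nat.find_min hex (by omega)), ?_⟩
  have := Nat.find_spec hex
  rwa [hm] at this

lemma exists_mem_Ioc {t : ℝ} (ht : 0 < t) :
    ∃ m, switchTime τ m < t ∧ t ≤ switchTime τ (m + 1) := by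
  obtain ⟨m, h1, h2⟩ := h.exists_mem_Ico ht.le
  rcases h1.lt_or_eq with h1 | h1
  · exact ⟨m, h1, h2.le⟩
  · obtain ⟨k, rfl⟩ := Nat.exists_eq_succ_of_ne_zero (n := m) fun h0 => by
      rw [h0, switchTime_zero] at h1; linarith
    exact ⟨k, h1 ▸ h.strictMono k.lt_succ_self, h1.ge⟩

lemma switchTime_numSwitches_le {t : ℝ} (ht : 0 ≤ t) : switchTime τ (numSwitches τ t) ≤ t := by
  obtain ⟨m, h1, h2⟩ := h.exists_mem_Ico ht
  rwa [h.numSwitches_of_mem h1 h2]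

lemma lt_switchTime_numSwitches {t : ℝ} (ht : 0 ≤ t) :
    t < switchTime τ (numSwitches τ t + 1) := by
  obtain ⟨m, h1, h2⟩ := h.exists_mem_Ico ht
  rwa [h.numSwitches_of_mem h1 h2]

lemma eventually_right {t : ℝ} (ht : 0 ≤ t) :
    ∀ᶠ s in 𝓝[>] t, numSwitches τ s = numSwitches τ t := by
  filter_upwards [Ioo_mem_nhdsGT (h.lt_switchTime_numSwitches ht)] with s hs
  exact h.numSwitches_of_mem ((h.switchTime_numSwitches_le ht).trans hs.1.le) hs.2

lemma eventually_left {t : ℝ} {m : ℕ} (h1 : switchTime τ m < t) (h2 : t ≤ switchTime τ (m + 1)) :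
    ∀ᶠ s in 𝓝[<] t, numSwitches τ s = m := by
  filter_upwards [Ioo_mem_nhdsLT h1] with s hs
  exact h.numSwitches_of_mem hs.1.le (hs.2.trans_le h2)

lemma numSwitches_zero : numSwitches τ 0 = 0 :=
  h.numSwitches_of_mem le_rfl (by rw [switchTime_succ, switchTime_zero]; linarith [h.pos 0])

lemma numSwitches_switchTime (m : ℕ) : numSwitches τ (switchTime τ m) = m :=
  h.numSwitches_of_mem le_rfl (h.strictMono m.lt_succ_self)

lemma tendsto_numSwitches : Tendsto (numSwitches τ) atTop atTop := by
  refine tendsto_atTop.2 fun m => ?_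
  filter_upwards [eventually_ge_atTop (switchTime τ m)] with t ht
  by_contra hlt
  have h0 : 0 ≤ t := (h.switchTime_nonneg m).trans ht
  exact absurd (h.lt_switchTime_numSwitches h0)
    (not_lt.2 ((h.strictMono.monotone (by omega)).trans ht))

/-- Elementary renewal theorem: if the holding times have mean `1 / r`, then `r t` reversals
happen up to time `t`, to first order. -/
lemma tendsto_numSwitches_div {r : ℝ} (hr : 0 < r)
    (hlim : Tendsto (fun n : ℕ => switchTime τ n / n) atTop (𝓝 (1 / r))) :
    Tendsto (fun t : ℝ => (numSwitches τ t : ℝ) / t) atTop (𝓝 r) := by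
  have hinv : Tendsto (fun n : ℕ => (n : ℝ) / switchTime τ n) atTop (𝓝 r) := by
    simpa using hlim.inv₀ (one_div_pos.2 hr).ne'
  have hup := hinv.comp h.tendsto_numSwitches
  have hratio : Tendsto (fun n : ℕ => (n : ℝ) / ((n : ℝ) + 1)) atTop (𝓝 1) :=
    tendsto_natCast_div_add_atTop 1
  have hlow : Tendsto (fun n : ℕ => (n : ℝ) / switchTime τ (n + 1)) atTop (𝓝 r) := by
    have h1 := hratio.mul (hinv.comp (tendsto_add_atTop_nat 1))
    rw [one_mul] at h1
    refine h1.congr fun n => ?_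
    have : ((n : ℝ) + 1) ≠ 0 := by positivity
    simp only [Function.comp_apply]
    push_cast
    field_simp
  refine tendsto_of_tendsto_of_tendsto_of_le_of_le' (hlow.comp h.tendsto_numSwitches) hup ?_ ?_
  · filter_upwards [eventually_gt_atTop 0] with t ht
    exact div_le_div_of_nonneg_left (Nat.cast_nonneg _) ht (h.lt_switchTime_numSwitches ht.le).le
  · filter_upwards [eventually_gt_atTop 0, h.tendsto_numSwitches.eventually_gt_atTop 0] with t ht hn
    refine div_le_div_of_nonneg_left (Nat.cast_nonneg _) ?_ (h.switchTime_numSwitches_le ht.le)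
    exact h.strictMono hn

/-- From averages over holding times to averages over time: if the average over `n` holding times
of reward minus running reward tends to `0`, so does the time average. -/
lemma tendsto_reward_div {r : ℝ} (hr : 0 < r)
    (hlim : Tendsto (fun n : ℕ => switchTime τ n / n) atTop (𝓝 (1 / r))) {R : ℕ → ℝ} {g : ℝ → ℝ}
    {C : ℝ} (hgm : Measurable g) (hg : ∀ s, |g s| ≤ C)
    (hR : Tendsto (fun n : ℕ => (∑ l ∈ Finset.range n,
      (R l - ∫ u in switchTime τ l..switchTime τ (l + 1), g u)) / n) atTop (𝓝 0)) :
    Tendsto (fun t : ℝ => (∑ l ∈ Finset.range (numSwitches τ t), R l - ∫ u in (0 : ℝ)..t, g u) / t)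
      atTop (𝓝 0) := by
  have hcount := h.tendsto_numSwitches_div hr hlim
  have h1 : Tendsto (fun t : ℝ => (∑ l ∈ Finset.range (numSwitches τ t),
      (R l - ∫ u in switchTime τ l..switchTime τ (l + 1), g u)) / t) atTop (𝓝 0) := by
    have := (hR.comp h.tendsto_numSwitches).mul hcount
    rw [zero_mul] at this
    refine this.congr' ?_
    filter_upwards [h.tendsto_numSwitches.eventually_gt_atTop 0] with t hn
    have : (numSwitches τ t : ℝ) ≠ 0 := by exact_mod_cast hn.ne'
    simp only [Function.comp_apply]
    field_simp
  have hT : Tendsto (fun t : ℝ => switchTime τ (numSwitches τ t) / t) atTop (𝓝 1) := by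
    have := (hlim.comp h.tendsto_numSwitches).mul hcount
    rw [one_div_mul_cancel hr.ne'] at this
    refine this.congr' ?_
    filter_upwards [h.tendsto_numSwitches.eventually_gt_atTop 0] with t hn
    have : (numSwitches τ t : ℝ) ≠ 0 := by exact_mod_cast hn.ne'
    simp only [Function.comp_apply]
    field_simp
  have h2 : Tendsto (fun t : ℝ => (∫ u in switchTime τ (numSwitches τ t)..t, g u) / t) atTop
      (𝓝 0) := by
    have h3 : Tendsto (fun t : ℝ => C * (1 - switchTime τ (numSwitches τ t) / t)) atTop (𝓝 0) := by
      simpa using (hT.const_sub 1).const_mul C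
    refine squeeze_zero_norm' ?_ h3
    filter_upwards [eventually_gt_atTop 0] with t ht
    have h4 := abs_intervalIntegral_le hg (switchTime τ (numSwitches τ t)) t
    rw [abs_of_nonneg (sub_nonneg.2 (h.switchTime_numSwitches_le ht.le))] at h4
    rw [Real.norm_eq_abs, abs_div, abs_of_pos ht, div_le_iff₀ ht]
    refine h4.trans_eq ?_
    field_simp
  have h5 := h1.sub h2
  rw [sub_zero] at h5
  refine h5.congr fun t => ?_
  have hint := intervalIntegrable_of_bounded hgm hg
  rw [← sub_div, Finset.sum_sub_distrib,
    intervalIntegral.sum_integral_adjacent_intervals fun k _ => hint _ _, switchTime_zero,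
    sub_sub, intervalIntegral.integral_add_adjacent_intervals (hint _ _) (hint _ _)]

end IsClock

/-! ### Carrier paths -/

/-- Induction along the half-line `[0, ∞)`. -/
lemma real_induction {p : ℝ → Prop} (h0 : p 0)
    (hright : ∀ t, 0 ≤ t → (∀ s, 0 ≤ s → s ≤ t → p s) → ∀ᶠ s in 𝓝[>] t, p s)
    (hleft : ∀ t, 0 < t → (∀ s, 0 ≤ s → s < t → p s) → p t) {t : ℝ} (ht : 0 ≤ t) : p t := by
  by_contra hpt
  set S : Set ℝ := {s | 0 ≤ s ∧ ¬ p s} with hS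
  have hne : S.Nonempty := ⟨t, ht, hpt⟩
  have hbd : BddBelow S := ⟨0, fun s hs => hs.1⟩
  have hm0 : 0 ≤ sInf S := le_csInf hne fun s hs => hs.1
  have hlt : ∀ s, 0 ≤ s → s < sInf S → p s := fun s hs0 hs => by
    by_contra hps
    exact absurd (csInf_le hbd ⟨hs0, hps⟩) (not_le.2 hs)
  have hpm : p (sInf S) := by
    rcases hm0.eq_or_lt with h | h
    · rwa [← h]
    · exact hleft _ h hlt
  have hle : ∀ s, 0 ≤ s → s ≤ sInf S → p s := fun s hs0 hs => by
    rcases hs.lt_or_eq with h | rfl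
    · exact hlt s hs0 h
    · exact hpm
  obtain ⟨u, hu, hsub⟩ := mem_nhdsGT_iff_exists_Ioo_subset.1 (hright _ hm0 hle)
  obtain ⟨s, hs, hsu⟩ := (csInf_lt_iff hbd hne).1 hu
  have h1 : sInf S ≤ s := csInf_le hbd hs
  rcases h1.lt_or_eq with h | h
  · exact hs.2 (hsub ⟨h, hsu⟩)
  · exact hs.2 (h ▸ hpm)

/-- At time `t` walker `k` hands over the message to the other walker, if it carries it. -/
def Handoff {S : Type*} (X : Fin 2 → ℝ → S) (D : Fin 2 → ℝ → ℤˣ) (k : Fin 2) (t : ℝ) : Prop :=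
  X k t = X k.rev t ∧ D k t = -1 ∧ D k.rev t = 1

open Classical in
/-- The carrier just before time `t`, read off from the handoffs in `[0, t)`: it is walker `1` if
the last of these was from `0` to `1`, or if `1` is the initial carrier and never met the condition
for handing over. -/
noncomputable def carrierBefore (H : Fin 2 → ℝ → Prop) (i : Fin 2) (t : ℝ) : Fin 2 :=
  if (∃ s, 0 ≤ s ∧ s < t ∧ H 0 s ∧ ∀ u, s < u → u < t → ¬ H 1 u) ∨
    (i = 1 ∧ ∀ u, 0 ≤ u → u < t → ¬ H 1 u) then 1 else 0

lemma Fin.eq_or_eq_rev (k l : Fin 2) : l = k ∨ l = k.rev := by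
  fin_cases k <;> fin_cases l <;> simp

lemma Fin.rev_ne_self (k : Fin 2) : k.rev ≠ k := by
  fin_cases k <;> simp

lemma Fin.sum_eq_add_rev (f : Fin 2 → ℝ) (j : Fin 2) : ∑ i, f i = f j + f j.rev := by
  fin_cases j <;> simp [Fin.sum_univ_two, add_comm]

/-- Handoffs do not accumulate at any time. -/
structure IsolatedHandoffs {S : Type*} (X : Fin 2 → ℝ → S) (D : Fin 2 → ℝ → ℤˣ) : Prop where
  right : ∀ t, 0 ≤ t → ∀ᶠ s in 𝓝[>] t, ∀ k, ¬ Handoff X D k s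
  left : ∀ t, 0 < t → ∀ᶠ s in 𝓝[<] t, ∀ k, ¬ Handoff X D k s

section

variable {S : Type*} {X : Fin 2 → ℝ → S} {D : Fin 2 → ℝ → ℤˣ} {i : Fin 2} {I : ℝ → Fin 2}

lemma transmit_of_handoff {k : Fin 2} {t : ℝ} (h : Handoff X D k t) :
    transmit (fun j => X j t) (fun j => D j t) k = k.rev := if_pos h

lemma transmit_of_not_handoff {k : Fin 2} {t : ℝ} (h : ¬ Handoff X D k t) :
    transmit (fun j => X j t) (fun j => D j t) k = k := if_neg h

lemma Handoff.not_rev {k : Fin 2} {t : ℝ} (h : Handoff X D k t) : ¬ Handoff X D k.rev t := by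
  intro h'
  have h2 := h'.2.2
  rw [Fin.rev_rev, h.2.1] at h2
  exact absurd h2 (by decide)

lemma not_handoff_transmit (k : Fin 2) (t : ℝ) :
    ¬ Handoff X D (transmit (fun j => X j t) (fun j => D j t) k) t := by
  by_cases h : Handoff X D k t
  · rw [transmit_of_handoff h]; exact h.not_rev
  · rwa [transmit_of_not_handoff h]

lemma carrierBefore_zero : carrierBefore (Handoff X D) i 0 = i := by
  have h1 : ¬ ∃ s : ℝ, 0 ≤ s ∧ s < 0 ∧ Handoff X D 0 s ∧ ∀ u, s < u → u < 0 → ¬ Handoff X D 1 u :=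
    fun ⟨s, h1, h2, _⟩ => absurd h1 (not_le.2 h2)
  have h2 : ∀ u : ℝ, 0 ≤ u → u < 0 → ¬ Handoff X D 1 u := fun u h1 h2 => absurd h1 (not_le.2 h2)
  rcases Fin.eq_or_eq_rev 0 i with rfl | rfl
  · simp [carrierBefore, h1]
  · rw [carrierBefore, if_pos (Or.inr ⟨rfl, h2⟩)]; rfl

lemma carrierBefore_eq_of_no_handoff {s t : ℝ} (hst : s ≤ t)
    (hno : ∀ u, s ≤ u → u < t → ∀ k, ¬ Handoff X D k u) :
    carrierBefore (Handoff X D) i t = carrierBefore (Handoff X D) i s := by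
  have e1 : (∃ z, 0 ≤ z ∧ z < t ∧ Handoff X D 0 z ∧ ∀ u, z < u → u < t → ¬ Handoff X D 1 u) ↔
      ∃ z, 0 ≤ z ∧ z < s ∧ Handoff X D 0 z ∧ ∀ u, z < u → u < s → ¬ Handoff X D 1 u := by
    constructor
    · rintro ⟨z, h0, hz, hH, hu⟩
      have hzs : z < s := not_le.1 fun h => hno z h hz 0 hH
      exact ⟨z, h0, hzs, hH, fun u h1 h2 => hu u h1 (h2.trans_le hst)⟩
    · rintro ⟨z, h0, hz, hH, hu⟩
      refine ⟨z, h0, hz.trans_le hst, hH, fun u h1 h2 => ?_⟩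
      rcases lt_or_ge u s with h | h
      exacts [hu u h1 h, hno u h h2 1]
  have e2 : (∀ u, 0 ≤ u → u < t → ¬ Handoff X D 1 u) ↔
      ∀ u, 0 ≤ u → u < s → ¬ Handoff X D 1 u := by
    refine ⟨fun h u h0 hu => h u h0 (hu.trans_le hst), fun h u h0 hu => ?_⟩
    rcases lt_or_ge u s with h' | h'
    exacts [h u h0 h', hno u h' hu 1]
  have e := or_congr e1 (and_congr (Iff.refl (i = 1)) e2)
  unfold carrierBefore
  by_cases h : (∃ z, 0 ≤ z ∧ z < s ∧ Handoff X D 0 z ∧ ∀ u, z < u → u < s → ¬ Handoff X D 1 u) ∨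
      (i = 1 ∧ ∀ u, 0 ≤ u → u < s → ¬ Handoff X D 1 u)
  · rw [if_pos h, if_pos (e.2 h)]
  · rw [if_neg h, if_neg (mt e.1 h)]

lemma carrierBefore_eq_transmit {s t : ℝ} (hs : 0 ≤ s) (hst : s < t)
    (hno : ∀ u, s < u → u < t → ∀ k, ¬ Handoff X D k u) :
    carrierBefore (Handoff X D) i t = transmit (fun j => X j s) (fun j => D j s)
      (carrierBefore (Handoff X D) i s) := by
  by_cases h0 : Handoff X D 0 s
  · have e : transmit (fun j => X j s) (fun j => D j s) (carrierBefore (Handoff X D) i s) = 1 := by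
      rcases Fin.eq_or_eq_rev 0 (carrierBefore (Handoff X D) i s) with h | h
      · rw [h, transmit_of_handoff h0]; rfl
      · rw [h, transmit_of_not_handoff h0.not_rev]; rfl
    rw [e, carrierBefore, if_pos]
    exact Or.inl ⟨s, hs, hst, h0, fun u h1 h2 => hno u h1 h2 1⟩
  by_cases h1 : Handoff X D 1 s
  · have e : transmit (fun j => X j s) (fun j => D j s) (carrierBefore (Handoff X D) i s) = 0 := by
      rcases Fin.eq_or_eq_rev 0 (carrierBefore (Handoff X D) i s) with h | h
      · rw [h, transmit_of_not_handoff h0]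
      · have h1' : Handoff X D (Fin.rev 0) s := h1
        rw [h, transmit_of_handoff h1']; rfl
    rw [e, carrierBefore, if_neg]
    rintro (⟨z, hz0, hz, hH, hu⟩ | ⟨_, hu⟩)
    · rcases lt_trichotomy z s with h | rfl | h
      · exact hu s h hst h1
      · exact h0 hH
      · exact hno z h hz 0 hH
    · exact hu s hs hst h1
  have hno' : ∀ k, ¬ Handoff X D k s := fun k => by
    rcases Fin.eq_or_eq_rev 0 k with rfl | rfl
    exacts [h0, h1]
  rw [transmit_of_not_handoff (hno' _)]
  refine carrierBefore_eq_of_no_handoff hst.le fun u h h' k => ?_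
  rcases h.eq_or_lt with rfl | h
  exacts [hno' k, hno u h h' k]

theorem IsolatedHandoffs.isCarrierPath (h : IsolatedHandoffs X D) :
    IsCarrierPath X D i fun t => transmit (fun j => X j t) (fun j => D j t)
      (carrierBefore (Handoff X D) i t) where
  right_cont t ht := by
    obtain ⟨u, hu, hsub⟩ := mem_nhdsGT_iff_exists_Ioo_subset.1 (h.right t ht)
    filter_upwards [Ioo_mem_nhdsGT hu] with s hs
    rw [transmit_of_not_handoff (hsub hs _)]
    exact carrierBefore_eq_transmit ht hs.1 fun w h1 h2 => hsub ⟨h1, h2.trans hs.2⟩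
  initial := by rw [carrierBefore_zero]
  step t ht := by
    refine ⟨carrierBefore (Handoff X D) i t, ?_, rfl⟩
    obtain ⟨u, hu, hsub⟩ := mem_nhdsLT_iff_exists_Ioo_subset.1 (h.left t ht)
    filter_upwards [Ioo_mem_nhdsLT (max_lt hu ht)] with s hs
    have hs' := max_lt_iff.1 hs.1
    rw [transmit_of_not_handoff (hsub ⟨hs'.1, hs.2⟩ _)]
    exact (carrierBefore_eq_of_no_handoff hs.2.le
      fun w h1 h2 => hsub ⟨hs'.1.trans_le h1, h2⟩).symm

lemma IsCarrierPath.unique {I' : ℝ → Fin 2} (hI : IsCarrierPath X D i I)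
    (hI' : IsCarrierPath X D i I') {t : ℝ} (ht : 0 ≤ t) : I t = I' t := by
  refine real_induction (p := fun t => I t = I' t) (hI.initial.trans hI'.initial.symm)
    (fun t ht h => ?_) (fun t ht h => ?_) ht
  · filter_upwards [hI.right_cont t ht, hI'.right_cont t ht] with s h1 h2
    rw [h1, h2, h t ht le_rfl]
  · obtain ⟨k, hk, e⟩ := hI.step t ht
    obtain ⟨k', hk', e'⟩ := hI'.step t ht
    obtain ⟨s, h1, h2, h3⟩ := (hk.and (hk'.and (Ioo_mem_nhdsLT ht))).exists
    rw [e, e', ← h1, ← h2, h s h3.1.le h3.2]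

lemma IsCarrierPath.eq_transmit (hI : IsCarrierPath X D i I) (h : IsolatedHandoffs X D) {t : ℝ}
    (ht : 0 ≤ t) : I t = transmit (fun j => X j t) (fun j => D j t)
      (carrierBefore (Handoff X D) i t) :=
  hI.unique h.isCarrierPath ht

lemma IsCarrierPath.eventually_left (hI : IsCarrierPath X D i I) (h : IsolatedHandoffs X D)
    {t : ℝ} (ht : 0 < t) : ∀ᶠ s in 𝓝[<] t, I s = carrierBefore (Handoff X D) i t := by
  obtain ⟨u, hu, hsub⟩ := mem_nhdsLT_iff_exists_Ioo_subset.1 (h.left t ht)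
  filter_upwards [Ioo_mem_nhdsLT (max_lt hu ht)] with s hs
  have hs' := max_lt_iff.1 hs.1
  rw [hI.eq_transmit h hs'.2.le, transmit_of_not_handoff (hsub ⟨hs'.1, hs.2⟩ _)]
  exact (carrierBefore_eq_of_no_handoff hs.2.le
    fun w h1 h2 => hsub ⟨hs'.1.trans_le h1, h2⟩).symm

/-! ### Counting the jumps of a carrier path -/

lemma continuousAt_iff_of_eventually_left {t : ℝ} {k : Fin 2} (hl : ∀ᶠ s in 𝓝[<] t, I s = k)
    (hr : ∀ᶠ s in 𝓝[>] t, I s = I t) : ContinuousAt I t ↔ I t = k := by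
  constructor
  · intro hc
    have h1 : ∀ᶠ s in 𝓝 t, I s = I t := by
      rwa [ContinuousAt, nhds_discrete (Fin 2), tendsto_pure] at hc
    obtain ⟨s, h2, h3⟩ := (hl.and (h1.filter_mono nhdsWithin_le_nhds)).exists
    rw [← h3, h2]
  · intro hk
    subst hk
    have h1 : ∀ᶠ s in 𝓝[≠] t, I s = I t := by
      rw [← Iio_union_Ioi, nhdsWithin_union]
      exact eventually_sup.2 ⟨hl, hr⟩
    rw [eventually_nhdsWithin_iff] at h1
    have h2 : I =ᶠ[𝓝 t] fun _ => I t := h1.mono fun s hs => by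
      rcases eq_or_ne s t with rfl | hne
      exacts [rfl, hs hne]
    exact continuousAt_const.congr h2.symm

lemma continuousAt_of_forall_mem_Ioo {a b s : ℝ} {k : Fin 2} (h : ∀ u ∈ Ioo a b, I u = k)
    (hs : s ∈ Ioo a b) : ContinuousAt I s := by
  have : I =ᶠ[𝓝 s] fun _ => k := by
    filter_upwards [Ioo_mem_nhds hs.1 hs.2] with u hu using h u hu
  exact continuousAt_const.congr this.symm

namespace IsCarrierPath

lemma jumpTimes_right (hI : IsCarrierPath X D i I) {t : ℝ} (ht : 0 ≤ t) :
    ∀ᶠ s in 𝓝[>] t, jumpTimes I s = jumpTimes I t := by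
  obtain ⟨u, hu, hsub⟩ := mem_nhdsGT_iff_exists_Ioo_subset.1 (hI.right_cont t ht)
  filter_upwards [Ioo_mem_nhdsGT hu] with s hs
  ext w
  simp only [jumpTimes, mem_ofPred_eq]
  refine ⟨fun ⟨h0, h1, h2⟩ => ⟨h0, not_lt.1 fun h => h2 ?_, h2⟩,
    fun ⟨h0, h1, h2⟩ => ⟨h0, h1.trans hs.1.le, h2⟩⟩
  exact continuousAt_of_forall_mem_Ioo (fun x hx => hsub hx) ⟨h, h1.trans_lt hs.2⟩

lemma jumpTimes_left (hI : IsCarrierPath X D i I) {t : ℝ} (ht : 0 < t) {k : Fin 2}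
    (hk : ∀ᶠ s in 𝓝[<] t, I s = k) :
    ∀ᶠ s in 𝓝[<] t, jumpTimes I t = if I t = k then jumpTimes I s else
      insert t (jumpTimes I s) := by
  obtain ⟨u, hu, hsub⟩ := mem_nhdsLT_iff_exists_Ioo_subset.1 hk
  filter_upwards [Ioo_mem_nhdsLT hu] with s hs
  have hc := continuousAt_iff_of_eventually_left hk (hI.right_cont t ht.le)
  have hmid : ∀ w, s < w → w < t → ContinuousAt I w := fun w h1 h2 =>
    continuousAt_of_forall_mem_Ioo (fun x hx => hsub hx) ⟨hs.1.trans h1, h2⟩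
  have key : ∀ w, w ∈ jumpTimes I t ↔ w ∈ jumpTimes I s ∨ (w = t ∧ I t ≠ k) := by
    intro w
    simp only [jumpTimes, mem_ofPred_eq]
    constructor
    · rintro ⟨h0, h1, h2⟩
      rcases h1.eq_or_lt with rfl | h1
      · exact Or.inr ⟨rfl, fun h => h2 (hc.2 h)⟩
      · exact Or.inl ⟨h0, not_lt.1 fun h => h2 (hmid w h h1), h2⟩
    · rintro (⟨h0, h1, h2⟩ | ⟨rfl, h⟩)
      · exact ⟨h0, h1.trans hs.2.le, h2⟩
      · exact ⟨ht, le_rfl, fun h' => h (hc.1 h')⟩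
  ext w
  rw [key w]
  split_ifs with h <;> simp [h, or_comm]

lemma finite_jumpTimes (hI : IsCarrierPath X D i I) (t : ℝ) : (jumpTimes I t).Finite := by
  have hempty : ∀ t ≤ 0, jumpTimes I t = ∅ := fun t ht =>
    eq_empty_of_forall_notMem fun s hs => absurd (hs.1.trans_le hs.2.1) (not_lt.2 ht)
  rcases le_or_gt t 0 with ht | ht
  · simp [hempty t ht]
  refine real_induction (p := fun t => (jumpTimes I t).Finite) (by simp [hempty])
    (fun t ht h => ?_) (fun t ht h => ?_) ht.le
  · filter_upwards [hI.jumpTimes_right ht] with s hs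
    rw [hs]
    exact h t ht le_rfl
  · obtain ⟨k, hk, -⟩ := hI.step t ht
    obtain ⟨s, h1, h2⟩ := ((hI.jumpTimes_left ht hk).and (Ioo_mem_nhdsLT ht)).exists
    rw [h1]
    split_ifs
    · exact h s h2.1.le h2.2
    · exact (h s h2.1.le h2.2).insert _

lemma ncard_jumpTimes_left (hI : IsCarrierPath X D i I) {t : ℝ} (ht : 0 < t) {k : Fin 2}
    (hk : ∀ᶠ s in 𝓝[<] t, I s = k) :
    ∀ᶠ s in 𝓝[<] t, ((jumpTimes I s).ncard : ℝ) =
      (jumpTimes I t).ncard - if I t = k then 0 else 1 := by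
  filter_upwards [hI.jumpTimes_left ht hk, self_mem_nhdsWithin] with s hs hst
  rw [hs]
  split_ifs
  · simp
  · have : t ∉ jumpTimes I s := fun h => absurd h.2.1 (not_le.2 hst)
    rw [ncard_insert_of_notMem this (hI.finite_jumpTimes s)]
    push_cast; ring

end IsCarrierPath

end

/-! ### Points moving uniformly on a circle -/

section

variable {N q c t : ℝ} {l : Filter ℝ}

lemma tendsto_affine_div (hl : l ≤ 𝓝 t) :
    Tendsto (fun s => (q + c * (s - t)) / N) l (𝓝 (q / N)) := by
  have : Continuous fun s : ℝ => (q + c * (s - t)) / N := by fun_prop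
  simpa using (this.tendsto t).mono_left hl

lemma mul_fract_eq_of_floor (hN : 0 < N) {x : ℝ} {n : ℤ} (h1 : n ≤ x / N) (h2 : x / N < n + 1) :
    N * Int.fract (x / N) = x - N * n := by
  rw [← Int.self_sub_floor, Int.floor_eq_iff.2 ⟨h1, h2⟩]
  field_simp

/-- Below, `l` is a one-sided neighbourhood filter of `t`, and a point on a circle of length `N` has
lifted position `q + c * (s - t)` at time `s`: moving upwards, its representative in `[0, N)`
varies linearly. -/
lemma mul_fract_affine_of_nonneg (hN : 0 < N) (hl : l ≤ 𝓝 t) (hc : ∀ᶠ s in l, 0 ≤ c * (s - t)) :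
    ∀ᶠ s in l, N * Int.fract ((q + c * (s - t)) / N) = N * Int.fract (q / N) + c * (s - t) := by
  filter_upwards [hc, (tendsto_affine_div (q := q) (c := c) (N := N) hl).eventually
    (gt_mem_nhds (Int.lt_floor_add_one (q / N)))] with s h1 h2
  rw [mul_fract_eq_of_floor hN (n := ⌊q / N⌋) _ h2,
    mul_fract_eq_of_floor hN (Int.floor_le (q / N)) (Int.lt_floor_add_one _)]
  · ring
  · exact (Int.floor_le _).trans (by gcongr; linarith)

lemma mul_fract_affine_of_ne_zero (hN : 0 < N) (hl : l ≤ 𝓝 t) (hq : N * Int.fract (q / N) ≠ 0) :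
    ∀ᶠ s in l, N * Int.fract ((q + c * (s - t)) / N) = N * Int.fract (q / N) + c * (s - t) := by
  have hlt : (⌊q / N⌋ : ℝ) < q / N := by
    have h1 : Int.fract (q / N) ≠ 0 := right_ne_zero_of_mul hq
    have h2 := (Int.fract_nonneg (q / N)).lt_of_ne' h1
    rw [← Int.self_sub_floor] at h2
    linarith
  have ht := tendsto_affine_div (q := q) (c := c) (N := N) hl
  filter_upwards [ht.eventually (lt_mem_nhds hlt),
    ht.eventually (gt_mem_nhds (Int.lt_floor_add_one (q / N)))] with s h1 h2
  rw [mul_fract_eq_of_floor hN h1.le h2,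
    mul_fract_eq_of_floor hN (Int.floor_le (q / N)) (Int.lt_floor_add_one _)]
  ring

/-- Just below a multiple of `N`, the representative in `[0, N)` is close to `N`. -/
lemma mul_fract_affine_of_neg (hN : 0 < N) (hl : l ≤ 𝓝 t) (hq : N * Int.fract (q / N) = 0)
    (hc : ∀ᶠ s in l, c * (s - t) < 0) :
    ∀ᶠ s in l, N * Int.fract ((q + c * (s - t)) / N) = N + c * (s - t) := by
  have hfl : q / N = ⌊q / N⌋ := by
    have h1 : Int.fract (q / N) = 0 := (mul_eq_zero.1 hq).resolve_left hN.ne'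
    rw [← Int.self_sub_floor] at h1
    linarith
  have hq' : q = N * ⌊q / N⌋ := by rw [← hfl]; field_simp
  filter_upwards [hc, (tendsto_affine_div (q := q) (c := c) (N := N) hl).eventually
    (lt_mem_nhds (sub_one_lt (q / N)))] with s h1 h2
  rw [mul_fract_eq_of_floor hN (n := ⌊q / N⌋ - 1)]
  · push_cast
    linarith
  · push_cast
    rw [← hfl]
    exact h2.le
  · push_cast
    rw [sub_add_cancel, ← hfl]
    gcongr
    linarith

lemma mul_fract_affine_ne_zero (hN : 0 < N) (hl : l ≤ 𝓝 t) (hc : ∀ᶠ s in l, c * (s - t) ≠ 0) :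
    ∀ᶠ s in l, N * Int.fract ((q + c * (s - t)) / N) ≠ 0 := by
  have ht := tendsto_affine_div (q := q) (c := c) (N := N) hl
  filter_upwards [hc, ht.eventually (lt_mem_nhds (show (⌈q / N⌉ : ℝ) - 1 < q / N by
    linarith [Int.ceil_lt_add_one (q / N)])),
    ht.eventually (gt_mem_nhds (Int.lt_floor_add_one (q / N)))] with s h1 h2 h3 h0
  have h4 : Int.fract ((q + c * (s - t)) / N) = 0 := (mul_eq_zero.1 h0).resolve_left hN.ne'
  rw [← Int.self_sub_floor, sub_eq_zero] at h4
  set n := ⌊(q + c * (s - t)) / N⌋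
  rw [h4] at h2 h3
  have h5 : ⌈q / N⌉ ≤ n := by
    have : ⌈q / N⌉ - 1 < n := by exact_mod_cast h2
    omega
  have h6 : n ≤ ⌊q / N⌋ := by
    have : n < ⌊q / N⌋ + 1 := by exact_mod_cast h3
    omega
  have h7 : q / N = n :=
    le_antisymm (Int.ceil_le.1 h5) (Int.le_floor.1 h6)
  rw [← h4, div_left_inj' hN.ne'] at h7
  exact h1 (by linarith)

end

lemma intervalIntegral_eq_of_Ioo {g : ℝ → ℝ} {a b c : ℝ} (hab : a ≤ b)
    (h : ∀ u ∈ Ioo a b, g u = c) :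
    ∫ u in a..b, g u = c * (b - a) := by
  rw [intervalIntegral.integral_congr_ae (g := fun _ => c), intervalIntegral.integral_const,
    smul_eq_mul, mul_comm]
  filter_upwards [Measure.ae_ne volume b] with u hu hmem
  rw [uIoc_of_le hab] at hmem
  exact h u ⟨hmem.1, hmem.2.lt_of_ne hu⟩

/-! ### Two walkers on a circle -/

/-- The deterministic data of two walkers on the circle `ℝ / Nℤ`: circumference, speed, real lifts
of the starting points, initial directions, and the initial carrier of the message. -/
structure TwoWalkers where
  /-- the circumference -/
  N : ℝ
  /-- the speed -/
  v : ℝ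
  /-- real representatives of the starting points -/
  start : Fin 2 → ℝ
  /-- the initial directions -/
  dir₀ : Fin 2 → ℤˣ
  /-- the walker that initially holds the message -/
  carrier₀ : Fin 2
  hN : 0 < N
  hv : 0 < v

/-- Both families of holding times are positive and not summable. -/
def IsNice (y : Fin 2 × ℕ → ℝ) : Prop := ∀ j, IsClock fun n => y (j, n)

namespace TwoWalkers

variable (S : TwoWalkers) (y : Fin 2 × ℕ → ℝ)

/-- The direction of walker `j`, as a unit of `ℤ`. -/
noncomputable def unitDir (j : Fin 2) (t : ℝ) : ℤˣ := direction (S.dir₀ j) (fun n => y (j, n)) t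

/-- The direction of walker `j`, as a real number. -/
noncomputable def dir (j : Fin 2) (t : ℝ) : ℝ := ((S.unitDir y j t : ℤ) : ℝ)

/-- The position of walker `j` on the circle. -/
noncomputable def pos (j : Fin 2) (t : ℝ) : AddCircle S.N :=
  position S.N S.v (S.start j) (S.dir₀ j) (fun n => y (j, n)) t

/-- The position of walker `j`, lifted to the real line. -/
noncomputable def lift (j : Fin 2) (t : ℝ) : ℝ := S.start j + S.v * ∫ u in (0 : ℝ)..t, S.dir y j u

/-- The lifted displacement from the other walker to walker `k`. -/
noncomputable def sep (k : Fin 2) (t : ℝ) : ℝ := S.lift y k t - S.lift y k.rev t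

/-- The clockwise distance in `[0, N)` from the other walker to walker `k`. -/
noncomputable def gap (k : Fin 2) (t : ℝ) : ℝ := S.N * Int.fract (S.sep y k t / S.N)

/-- A countable family of times that contains all handoffs: after a handoff by `k` the lifted
displacement decreases at speed `2 v` from a multiple `m N` of the circumference, so the time of
the handoff can be recovered from the displacement at a slightly later rational time `p.1`. -/
noncomputable def candidateTime (p : ℚ × ℤ × Fin 2) : ℝ :=
  p.1 + (S.sep y p.2.2 p.1 - p.2.1 * S.N) / (2 * S.v)

open Classical in
/-- The carrier just before time `t`; for nice holding times this is `carrierBefore`, but as the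
quantifiers range over the countably many candidate times only, it is measurable in `y` and `t`. -/
noncomputable def carrier (t : ℝ) : Fin 2 :=
  if (∃ p, 0 ≤ S.candidateTime y p ∧ S.candidateTime y p < t ∧
        Handoff (S.pos y) (S.unitDir y) 0 (S.candidateTime y p) ∧
        ∀ p', S.candidateTime y p < S.candidateTime y p' → S.candidateTime y p' < t →
          ¬ Handoff (S.pos y) (S.unitDir y) 1 (S.candidateTime y p')) ∨
      (S.carrier₀ = 1 ∧ ∀ p, 0 ≤ S.candidateTime y p → S.candidateTime y p < t →
        ¬ Handoff (S.pos y) (S.unitDir y) 1 (S.candidateTime y p)) then 1 else 0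

variable {S y}

lemma gap_nonneg (k : Fin 2) (t : ℝ) : 0 ≤ S.gap y k t :=
  mul_nonneg S.hN.le (Int.fract_nonneg _)

lemma gap_le (k : Fin 2) (t : ℝ) : S.gap y k t ≤ S.N :=
  mul_le_of_le_one_right S.hN.le (Int.fract_lt_one _).le

lemma dir_eq_one_or (j : Fin 2) (t : ℝ) : S.dir y j t = 1 ∨ S.dir y j t = -1 := by
  rcases Int.units_eq_one_or (S.unitDir y j t) with h | h <;> simp [dir, h]

lemma abs_dir (j : Fin 2) (t : ℝ) : |S.dir y j t| ≤ 1 := by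
  rcases dir_eq_one_or (S := S) (y := y) j t with h | h <;> simp [h]

lemma handoff_iff (k : Fin 2) (t : ℝ) : Handoff (S.pos y) (S.unitDir y) k t ↔
    S.gap y k t = 0 ∧ S.unitDir y k t = -1 ∧ S.unitDir y k.rev t = 1 := by
  refine and_congr_left fun _ => ?_
  have e : ∀ j, S.pos y j t = ((S.lift y j t : ℝ) : AddCircle S.N) := fun j => by
    simp only [pos, position, lift, AddCircle.coe_add]
    rfl
  rw [e, e, ← sub_eq_zero, ← AddCircle.coe_sub, AddCircle.coe_eq_zero_iff, gap, mul_eq_zero,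
    or_iff_right S.hN.ne', Int.fract_eq_zero_iff, sep]
  have hN := S.hN.ne'
  constructor
  · rintro ⟨n, hn⟩
    refine ⟨n, ?_⟩
    rw [← hn, zsmul_eq_mul]
    field_simp
  · rintro ⟨n, hn⟩
    refine ⟨n, ?_⟩
    rw [zsmul_eq_mul, hn]
    field_simp

/-! ### Measurability of the motion -/

lemma measurable_comp_unitDir {β : Type*} [MeasurableSpace β] (f : ℤˣ → β) (j : Fin 2) :
    Measurable fun q : (Fin 2 × ℕ → ℝ) × ℝ => f (S.unitDir q.1 j q.2) := by
  have hsw : ∀ n, Measurable fun q : (Fin 2 × ℕ → ℝ) × ℝ => switchTime (fun k => q.1 (j, k)) n :=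
    fun n => Finset.measurable_sum _ fun k _ => (measurable_pi_apply (j, k)).comp measurable_fst
  have hset : Measurable fun q : (Fin 2 × ℕ → ℝ) × ℝ =>
      {n : ℕ | 1 ≤ n ∧ switchTime (fun k => q.1 (j, k)) n ≤ q.2} := by
    refine measurable_set_iff.2 fun n => ?_
    exact Measurable.and measurable_const
      (measurableSet_setOfPred.1 (measurableSet_le (hsw n) measurable_snd))
  exact (Measurable.of_discrete (f := fun n : ℕ => f (S.dir₀ j * (-1) ^ n))).comp
    (measurable_ncard.comp hset)

lemma measurable_dir (j : Fin 2) :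
    Measurable fun q : (Fin 2 × ℕ → ℝ) × ℝ => S.dir q.1 j q.2 :=
  measurable_comp_unitDir (fun u : ℤˣ => ((u : ℤ) : ℝ)) j

lemma measurable_sep (k : Fin 2) :
    Measurable fun q : (Fin 2 × ℕ → ℝ) × ℝ => S.sep q.1 k q.2 := by
  have h : ∀ j, Measurable fun q : (Fin 2 × ℕ → ℝ) × ℝ => S.lift q.1 j q.2 := fun j =>
    measurable_const.add ((measurable_primitive (h := fun y t => S.dir y j t)
      (measurable_dir j)).const_mul S.v)
  exact (h k).sub (h k.rev)

lemma measurable_gap (k : Fin 2) :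
    Measurable fun q : (Fin 2 × ℕ → ℝ) × ℝ => S.gap q.1 k q.2 :=
  (measurable_fract.comp ((measurable_sep k).div_const _)).const_mul _

lemma measurable_handoff (k : Fin 2) :
    Measurable fun q : (Fin 2 × ℕ → ℝ) × ℝ => Handoff (S.pos q.1) (S.unitDir q.1) k q.2 := by
  simp only [handoff_iff]
  exact (measurableSet_setOfPred.1 (measurableSet_eq_fun (measurable_gap k) measurable_const)).and
    ((measurable_comp_unitDir (fun u => u = -1) k).and
      (measurable_comp_unitDir (fun u => u = 1) k.rev))

lemma measurable_candidateTime (p : ℚ × ℤ × Fin 2) :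
    Measurable fun y => S.candidateTime y p := by
  have hp : Measurable fun y : Fin 2 × ℕ → ℝ => (y, (p.1 : ℝ)) :=
    measurable_id.prodMk measurable_const
  have h := (measurable_sep (S := S) p.2.2).comp hp
  have h' := ((h.sub_const (p.2.1 * S.N)).div_const (2 * S.v)).const_add (p.1 : ℝ)
  exact h'

lemma measurable_carrier : Measurable fun q : (Fin 2 × ℕ → ℝ) × ℝ => S.carrier q.1 q.2 := by
  have hc : ∀ p, Measurable fun q : (Fin 2 × ℕ → ℝ) × ℝ => S.candidateTime q.1 p := fun p => by
    have hf : Measurable (Prod.fst : (Fin 2 × ℕ → ℝ) × ℝ → _) := measurable_fst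
    have h := (measurable_candidateTime (S := S) p).comp hf
    exact h
  have hH : ∀ k p, Measurable fun q : (Fin 2 × ℕ → ℝ) × ℝ =>
      Handoff (S.pos q.1) (S.unitDir q.1) k (S.candidateTime q.1 p) := fun k p => by
    have h := (measurable_handoff (S := S) k).comp (measurable_fst.prodMk (hc p))
    exact h
  have h0 : ∀ p, Measurable fun q : (Fin 2 × ℕ → ℝ) × ℝ => 0 ≤ S.candidateTime q.1 p := fun p =>
    measurableSet_setOfPred.1 (measurableSet_le measurable_const (hc p))
  have ht : ∀ p, Measurable fun q : (Fin 2 × ℕ → ℝ) × ℝ => S.candidateTime q.1 p < q.2 := fun p =>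
    measurableSet_setOfPred.1 (measurableSet_lt (hc p) measurable_snd)
  have hlt : ∀ p p', Measurable fun q : (Fin 2 × ℕ → ℝ) × ℝ =>
      S.candidateTime q.1 p < S.candidateTime q.1 p' := fun p p' =>
    measurableSet_setOfPred.1 (measurableSet_lt (hc p) (hc p'))
  unfold carrier
  refine Measurable.ite (measurableSet_setOfPred.2 ?_) measurable_const measurable_const
  refine Measurable.or (Measurable.exists fun p => ?_) (measurable_const.and
    (Measurable.forall fun p => (h0 p).imp ((ht p).imp (hH 1 p).not)))
  exact (h0 p).and ((ht p).and ((hH 0 p).and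
    (Measurable.forall fun p' => (hlt p p').imp ((ht p').imp (hH 1 p').not))))

lemma measurable_dir_section (j : Fin 2) : Measurable (S.dir y j) := by
  have hp : Measurable fun t : ℝ => (y, t) := measurable_prodMk_left
  have h := (measurable_dir (S := S) j).comp hp
  exact h

/-! ### Local description of the motion -/

lemma lift_sub_lift (j : Fin 2) (s t : ℝ) :
    S.lift y j t - S.lift y j s = S.v * ∫ u in s..t, S.dir y j u := by
  have hi := intervalIntegrable_of_bounded (measurable_dir_section (S := S) (y := y) j) (abs_dir j)
  rw [lift, lift, ← intervalIntegral.integral_interval_sub_left (hi 0 t) (hi 0 s)]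
  ring

lemma unitDir_right (h : IsNice y) {t : ℝ} (ht : 0 ≤ t) :
    ∀ᶠ s in 𝓝[>] t, ∀ j, S.unitDir y j s = S.unitDir y j t := by
  refine eventually_all.2 fun j => ?_
  filter_upwards [(h j).eventually_right ht] with s hs
  simp only [unitDir, direction, hs]

lemma sep_right (h : IsNice y) (k : Fin 2) {t : ℝ} (ht : 0 ≤ t) :
    ∀ᶠ s in 𝓝[>] t, S.sep y k s =
      S.sep y k t + S.v * (S.dir y k t - S.dir y k.rev t) * (s - t) := by
  obtain ⟨u, hu, hsub⟩ := mem_nhdsGT_iff_exists_Ioo_subset.1 (unitDir_right (S := S) h ht)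
  filter_upwards [Ioo_mem_nhdsGT hu] with s hs
  have e : ∀ j, S.lift y j s = S.lift y j t + S.v * (S.dir y j t * (s - t)) := fun j => by
    rw [← intervalIntegral_eq_of_Ioo (g := S.dir y j) hs.1.le fun w hw => ?_, ← lift_sub_lift]
    · ring
    · simp only [dir, hsub (show w ∈ Ioo t u from ⟨hw.1, hw.2.trans hs.2⟩) j]
  rw [sep, sep, e, e]
  ring

/-- The direction of walker `j` during its `m`-th holding time. -/
noncomputable def phaseDir (S : TwoWalkers) (j : Fin 2) (m : ℕ) : ℤˣ := S.dir₀ j * (-1) ^ m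

variable {m : Fin 2 → ℕ}

lemma unitDir_left (h : IsNice y) {t : ℝ}
    (hm : ∀ j, switchTime (fun n => y (j, n)) (m j) < t ∧
      t ≤ switchTime (fun n => y (j, n)) (m j + 1)) :
    ∀ᶠ s in 𝓝[<] t, ∀ j, S.unitDir y j s = S.phaseDir j (m j) := by
  refine eventually_all.2 fun j => ?_
  filter_upwards [(h j).eventually_left (hm j).1 (hm j).2] with s hs
  simp only [unitDir, direction, hs, phaseDir]

lemma sep_left (h : IsNice y) (k : Fin 2) {t : ℝ}
    (hm : ∀ j, switchTime (fun n => y (j, n)) (m j) < t ∧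
      t ≤ switchTime (fun n => y (j, n)) (m j + 1)) :
    ∀ᶠ s in 𝓝[<] t, S.sep y k s = S.sep y k t +
      S.v * (((S.phaseDir k (m k) : ℤ) : ℝ) - ((S.phaseDir k.rev (m k.rev) : ℤ) : ℝ)) *
        (s - t) := by
  obtain ⟨u, hu, hsub⟩ := mem_nhdsLT_iff_exists_Ioo_subset.1 (unitDir_left (S := S) h hm)
  filter_upwards [Ioo_mem_nhdsLT hu] with s hs
  have e : ∀ j, S.lift y j t =
      S.lift y j s + S.v * (((S.phaseDir j (m j) : ℤ) : ℝ) * (t - s)) := fun j => by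
    rw [← intervalIntegral_eq_of_Ioo (g := S.dir y j) hs.2.le fun w hw => ?_, ← lift_sub_lift]
    · ring
    · simp only [dir, hsub (show w ∈ Ioo u t from ⟨hs.1.trans hw.1, hw.2⟩) j]
  rw [sep, sep, e k, e k.rev]
  ring

/-- `m j` is the number of reversals of walker `j` before time `t`. -/
lemma exists_phase (h : IsNice y) {t : ℝ} (ht : 0 < t) : ∃ m : Fin 2 → ℕ, ∀ j,
    switchTime (fun n => y (j, n)) (m j) < t ∧ t ≤ switchTime (fun n => y (j, n)) (m j + 1) :=
  Classical.skolem.1 fun j => (h j).exists_mem_Ioc ht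

lemma isolatedHandoffs (h : IsNice y) : IsolatedHandoffs (S.pos y) (S.unitDir y) where
  right t ht := by
    refine eventually_all.2 fun k => ?_
    by_cases hd : S.dir y k t = S.dir y k.rev t
    · filter_upwards [unitDir_right (S := S) h ht] with s hs hH
      have h1 := hH.2
      rw [hs, hs] at h1
      simp [dir, h1] at hd
      norm_num at hd
    · have hne := mul_fract_affine_ne_zero (N := S.N) (q := S.sep y k t) (t := t)
        (c := S.v * (S.dir y k t - S.dir y k.rev t)) S.hN (l := 𝓝[>] t) nhdsWithin_le_nhds (by
          filter_upwards [self_mem_nhdsWithin] with s hs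
          exact mul_ne_zero (mul_ne_zero S.hv.ne' (sub_ne_zero.2 hd)) (sub_ne_zero.2 (ne_of_gt hs)))
      filter_upwards [hne, sep_right (S := S) h k ht] with s h1 h2 hH
      rw [← h2] at h1
      exact h1 ((handoff_iff k s).1 hH).1
  left t ht := by
    obtain ⟨m, hm⟩ := exists_phase h ht
    refine eventually_all.2 fun k => ?_
    by_cases hd : ((S.phaseDir k (m k) : ℤ) : ℝ) = ((S.phaseDir k.rev (m k.rev) : ℤ) : ℝ)
    · filter_upwards [unitDir_left (S := S) h hm] with s hs hH
      have h1 := hH.2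
      rw [hs, hs] at h1
      simp [h1] at hd
      norm_num at hd
    · have hne := mul_fract_affine_ne_zero (N := S.N) (q := S.sep y k t) (t := t)
        (c := S.v * (((S.phaseDir k (m k) : ℤ) : ℝ) - ((S.phaseDir k.rev (m k.rev) : ℤ) : ℝ)))
        S.hN (l := 𝓝[<] t) nhdsWithin_le_nhds (by
          filter_upwards [self_mem_nhdsWithin] with s hs
          exact mul_ne_zero (mul_ne_zero S.hv.ne' (sub_ne_zero.2 hd)) (sub_ne_zero.2 (ne_of_lt hs)))
      filter_upwards [hne, sep_left (S := S) h k hm] with s h1 h2 hH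
      rw [← h2] at h1
      exact h1 ((handoff_iff k s).1 hH).1

lemma exists_candidateTime_eq (h : IsNice y) {k : Fin 2} {t : ℝ} (ht : 0 ≤ t)
    (hH : Handoff (S.pos y) (S.unitDir y) k t) : ∃ p, S.candidateTime y p = t := by
  obtain ⟨u, hu, hsub⟩ := mem_nhdsGT_iff_exists_Ioo_subset.1 (sep_right (S := S) h k ht)
  obtain ⟨p, hp1, hp2⟩ := exists_rat_btwn (mem_Ioi.1 hu)
  have hs := hsub (show (p : ℝ) ∈ Ioo t u from ⟨hp1, hp2⟩)
  obtain ⟨h1, h2, h3⟩ := (handoff_iff k t).1 hH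
  have h4 : Int.fract (S.sep y k t / S.N) = 0 := (mul_eq_zero.1 h1).resolve_left S.hN.ne'
  obtain ⟨n, hn⟩ := Int.fract_eq_zero_iff.1 h4
  refine ⟨(p, n, k), ?_⟩
  have hv := S.hv.ne'
  have hN := S.hN.ne'
  simp only [mem_ofPred_eq, dir, h2, h3] at hs
  have hn' : S.sep y k t = n * S.N := by rw [hn]; field_simp
  simp only [candidateTime, hs, hn']
  push_cast
  field_simp
  ring

lemma carrier_eq (h : IsNice y) (t : ℝ) :
    S.carrier y t = carrierBefore (Handoff (S.pos y) (S.unitDir y)) S.carrier₀ t := by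
  have key : (((∃ p, 0 ≤ S.candidateTime y p ∧ S.candidateTime y p < t ∧
        Handoff (S.pos y) (S.unitDir y) 0 (S.candidateTime y p) ∧
        ∀ p', S.candidateTime y p < S.candidateTime y p' → S.candidateTime y p' < t →
          ¬ Handoff (S.pos y) (S.unitDir y) 1 (S.candidateTime y p')) ∨
      (S.carrier₀ = 1 ∧ ∀ p, 0 ≤ S.candidateTime y p → S.candidateTime y p < t →
        ¬ Handoff (S.pos y) (S.unitDir y) 1 (S.candidateTime y p)))) ↔
      ((∃ s, 0 ≤ s ∧ s < t ∧ Handoff (S.pos y) (S.unitDir y) 0 s ∧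
        ∀ u, s < u → u < t → ¬ Handoff (S.pos y) (S.unitDir y) 1 u) ∨
      (S.carrier₀ = 1 ∧ ∀ u, 0 ≤ u → u < t → ¬ Handoff (S.pos y) (S.unitDir y) 1 u)) := by
    refine or_congr ⟨?_, ?_⟩ (and_congr Iff.rfl ⟨?_, ?_⟩)
    · rintro ⟨p, h0, h1, h2, h3⟩
      refine ⟨_, h0, h1, h2, fun u hu1 hu2 hu => ?_⟩
      obtain ⟨p', rfl⟩ := exists_candidateTime_eq h (h0.trans hu1.le) hu
      exact h3 p' hu1 hu2 hu
    · rintro ⟨s, h0, h1, h2, h3⟩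
      obtain ⟨p, rfl⟩ := exists_candidateTime_eq h h0 h2
      exact ⟨p, h0, h1, h2, fun p' => h3 _⟩
    · intro h1 u hu0 hut hu
      obtain ⟨p, rfl⟩ := exists_candidateTime_eq h hu0 hu
      exact h1 p hu0 hut hu
    · exact fun h1 p => h1 _
  unfold carrier carrierBefore
  by_cases hc : ((∃ s, 0 ≤ s ∧ s < t ∧ Handoff (S.pos y) (S.unitDir y) 0 s ∧
        ∀ u, s < u → u < t → ¬ Handoff (S.pos y) (S.unitDir y) 1 u) ∨
      (S.carrier₀ = 1 ∧ ∀ u, 0 ≤ u → u < t → ¬ Handoff (S.pos y) (S.unitDir y) 1 u))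
  · rw [if_pos hc, if_pos (key.2 hc)]
  · rw [if_neg hc, if_neg (mt key.1 hc)]

lemma countable_handoff (h : IsNice y) :
    {t | 0 ≤ t ∧ ∃ k, Handoff (S.pos y) (S.unitDir y) k t}.Countable := by
  refine (countable_range (S.candidateTime y)).mono ?_
  rintro t ⟨h0, k, hk⟩
  exact exists_candidateTime_eq h h0 hk

end TwoWalkers

/-! ### Observables and the rewards they produce -/

/-- A smooth observable `φ h a b` of the state of the system, where `h` is the gap from the other
walker to the carrier and `a`, `b` are the directions of the carrier and of the other walker.
`φ'` is its derivative in `h`; it has no jump when the gap wraps around the circle and increases by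
`β` at each handoff. -/
structure IsObservable (N : ℝ) (φ φ' : ℝ → ℝ → ℝ → ℝ) (β : ℝ) : Prop where
  cont : Continuous fun p : ℝ × ℝ × ℝ => φ p.1 p.2.1 p.2.2
  cont' : Continuous fun p : ℝ × ℝ × ℝ => φ' p.1 p.2.1 p.2.2
  deriv : ∀ h a b, HasDerivAt (fun x => φ x a b) (φ' h a b) h
  wrap : φ N 1 (-1) = φ 0 1 (-1)
  handoff : φ 0 1 (-1) = φ 0 (-1) 1 + β

lemma exists_bound_of_continuous {φ : ℝ → ℝ → ℝ → ℝ}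
    (hφ : Continuous fun p : ℝ × ℝ × ℝ => φ p.1 p.2.1 p.2.2) (N : ℝ) :
    ∃ C, ∀ h a b, 0 ≤ h → h ≤ N → |a| ≤ 1 → |b| ≤ 1 → |φ h a b| ≤ C := by
  have hK : IsCompact (Icc (0 : ℝ) N ×ˢ (Icc (-1 : ℝ) 1 ×ˢ Icc (-1 : ℝ) 1)) :=
    isCompact_Icc.prod (isCompact_Icc.prod isCompact_Icc)
  obtain ⟨C, hC⟩ := hK.exists_bound_of_continuousOn hφ.continuousOn
  refine ⟨C, fun h a b h0 hN ha hb => ?_⟩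
  exact hC (h, a, b) ⟨⟨h0, hN⟩, abs_le.1 ha, abs_le.1 hb⟩

namespace TwoWalkers

variable (S : TwoWalkers) (φ : ℝ → ℝ → ℝ → ℝ) (y : Fin 2 × ℕ → ℝ)

/-- The value of the observable `φ` at time `t` if `k` is the carrier and `e` are the directions. -/
noncomputable def obs (k : Fin 2) (t : ℝ) (e : Fin 2 → ℝ) : ℝ := φ (S.gap y k t) (e k) (e k.rev)

/-- The change of the observable `φ` when walker `j` reverses its direction. -/
noncomputable def flipGain (k : Fin 2) (t : ℝ) (e : Fin 2 → ℝ) (j : Fin 2) : ℝ :=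
  S.obs φ y k t (Function.update e j (-e j)) - S.obs φ y k t e

/-- The change of the observable `φ` that a reversal of walker `j` at time `t` would cause. -/
noncomputable def gainRate (j : Fin 2) (t : ℝ) : ℝ :=
  S.flipGain φ y (S.carrier y t) t (fun i => S.dir y i t) j

/-- The change of the observable `φ` at the end of the `l`-th holding time of walker `j`. Only the
direction of walker `j` is taken from before that time, as no other direction changes then. -/
noncomputable def reversalGain (j : Fin 2) (l : ℕ) : ℝ :=
  S.flipGain φ y (S.carrier y (switchTime (fun n => y (j, n)) (l + 1)))
    (switchTime (fun n => y (j, n)) (l + 1))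
    (Function.update (fun i => S.dir y i (switchTime (fun n => y (j, n)) (l + 1))) j
      ((S.phaseDir j l : ℤ) : ℝ)) j

/-- The speed at which an observable with derivative `φ` changes between reversals and handoffs. -/
noncomputable def drift (t : ℝ) : ℝ :=
  φ (S.gap y (S.carrier y t) t) (S.dir y (S.carrier y t) t) (S.dir y (S.carrier y t).rev t) *
    (S.v * (S.dir y (S.carrier y t) t - S.dir y (S.carrier y t).rev t))

variable {S φ y}

lemma measurable_of_carrier {F : Fin 2 → (Fin 2 × ℕ → ℝ) × ℝ → ℝ} (hF : ∀ k, Measurable (F k)) :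
    Measurable fun q : (Fin 2 × ℕ → ℝ) × ℝ => F (S.carrier q.1 q.2) q := by
  have e : (fun q : (Fin 2 × ℕ → ℝ) × ℝ => F (S.carrier q.1 q.2) q) =
      fun q => if S.carrier q.1 q.2 = 0 then F 0 q else F 1 q := by
    funext q
    rcases Fin.eq_or_eq_rev 0 (S.carrier q.1 q.2) with h | h <;> rw [h] <;> simp
  rw [e]
  exact Measurable.ite (measurable_carrier (measurableSet_singleton 0)) (hF 0) (hF 1)

lemma measurable_obs (hφ : Continuous fun p : ℝ × ℝ × ℝ => φ p.1 p.2.1 p.2.2) (k : Fin 2)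
    {e : (Fin 2 × ℕ → ℝ) × ℝ → Fin 2 → ℝ} (he : ∀ j, Measurable fun q => e q j) :
    Measurable fun q : (Fin 2 × ℕ → ℝ) × ℝ => S.obs φ q.1 k q.2 (e q) := by
  have h := hφ.measurable.comp ((measurable_gap (S := S) k).prodMk ((he k).prodMk (he k.rev)))
  exact h

lemma measurable_gainRate (hφ : Continuous fun p : ℝ × ℝ × ℝ => φ p.1 p.2.1 p.2.2) (j : Fin 2) :
    Measurable fun q : (Fin 2 × ℕ → ℝ) × ℝ => S.gainRate φ q.1 j q.2 := by
  have h := measurable_of_carrier (S := S) (F := fun k q =>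
    S.flipGain φ q.1 k q.2 (fun i => S.dir q.1 i q.2) j) fun k => by
      refine (measurable_obs hφ k fun i => ?_).sub (measurable_obs hφ k fun i => measurable_dir i)
      by_cases hij : i = j
      · subst hij
        simp only [Function.update_self]
        exact (measurable_dir (S := S) i).neg
      · simpa [Function.update_of_ne hij] using measurable_dir (S := S) i
  exact h

lemma measurable_drift (hφ : Continuous fun p : ℝ × ℝ × ℝ => φ p.1 p.2.1 p.2.2) :
    Measurable fun q : (Fin 2 × ℕ → ℝ) × ℝ => S.drift φ q.1 q.2 := by
  have h := measurable_of_carrier (S := S) (F := fun k q =>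
    S.obs φ q.1 k q.2 (fun i => S.dir q.1 i q.2) * (S.v * (S.dir q.1 k q.2 - S.dir q.1 k.rev q.2)))
    fun k => (measurable_obs hφ k fun i => measurable_dir i).mul
      (((measurable_dir k).sub (measurable_dir k.rev)).const_mul S.v)
  exact h

lemma abs_obs_le {C : ℝ}
    (hC : ∀ h a b, 0 ≤ h → h ≤ S.N → |a| ≤ 1 → |b| ≤ 1 → |φ h a b| ≤ C) (k : Fin 2) (t : ℝ)
    {e : Fin 2 → ℝ} (he : ∀ j, |e j| ≤ 1) : |S.obs φ y k t e| ≤ C :=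
  hC _ _ _ (gap_nonneg k t) (gap_le k t) (he k) (he k.rev)

lemma abs_gainRate_le {C : ℝ}
    (hC : ∀ h a b, 0 ≤ h → h ≤ S.N → |a| ≤ 1 → |b| ≤ 1 → |φ h a b| ≤ C) (j : Fin 2) (t : ℝ) :
    |S.gainRate φ y j t| ≤ C + C := by
  refine (abs_sub _ _).trans (add_le_add (abs_obs_le hC _ _ fun i => ?_)
    (abs_obs_le hC _ _ fun i => abs_dir i t))
  by_cases hij : i = j
  · subst hij
    simpa using abs_dir i t
  · simpa [Function.update_of_ne hij] using abs_dir i t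

lemma abs_drift_le {C : ℝ}
    (hC : ∀ h a b, 0 ≤ h → h ≤ S.N → |a| ≤ 1 → |b| ≤ 1 → |φ h a b| ≤ C) (t : ℝ) :
    |S.drift φ y t| ≤ C * (S.v * 2) := by
  rw [drift, abs_mul, abs_mul, abs_of_pos S.hv]
  have h1 := abs_obs_le (y := y) hC (S.carrier y t) t (e := fun i => S.dir y i t)
    fun i => abs_dir i t
  have hC0 : 0 ≤ C := (abs_nonneg _).trans h1
  have h2 : |S.dir y (S.carrier y t) t - S.dir y (S.carrier y t).rev t| ≤ 2 := by
    refine (abs_sub _ _).trans ?_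
    linarith [abs_dir (S := S) (y := y) (S.carrier y t) t,
      abs_dir (S := S) (y := y) (S.carrier y t).rev t]
  exact mul_le_mul h1 (mul_le_mul_of_nonneg_left h2 S.hv.le)
    (mul_nonneg S.hv.le (abs_nonneg _)) hC0

/-! ### Suppressing the reversals of one walker -/

lemma carrierBefore_congr {H H' : Fin 2 → ℝ → Prop} {i : Fin 2} {t : ℝ}
    (h : ∀ u, 0 ≤ u → u < t → ∀ k, H k u ↔ H' k u) :
    carrierBefore H i t = carrierBefore H' i t := by
  have key : ((∃ s, 0 ≤ s ∧ s < t ∧ H 0 s ∧ ∀ u, s < u → u < t → ¬ H 1 u) ∨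
      (i = 1 ∧ ∀ u, 0 ≤ u → u < t → ¬ H 1 u)) ↔
      ((∃ s, 0 ≤ s ∧ s < t ∧ H' 0 s ∧ ∀ u, s < u → u < t → ¬ H' 1 u) ∨
      (i = 1 ∧ ∀ u, 0 ≤ u → u < t → ¬ H' 1 u)) := by
    refine or_congr (exists_congr fun s => and_congr_right fun h0 => and_congr_right fun h1 =>
      and_congr (h s h0 h1 0) (forall_congr' fun u => forall_congr' fun h2 =>
        forall_congr' fun h3 => not_congr (h u (h0.trans h2.le) h3 1)))
        (and_congr_right fun _ => forall_congr' fun u => forall_congr' fun h2 =>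
          forall_congr' fun h3 => not_congr (h u h2 h3 1))
  unfold carrierBefore
  by_cases hc : ((∃ s, 0 ≤ s ∧ s < t ∧ H' 0 s ∧ ∀ u, s < u → u < t → ¬ H' 1 u) ∨
      (i = 1 ∧ ∀ u, 0 ≤ u → u < t → ¬ H' 1 u))
  · rw [if_pos hc, if_pos (key.2 hc)]
  · rw [if_neg hc, if_neg (mt key.1 hc)]

lemma override_of_ne {j j' : Fin 2} (hj : j' ≠ j) (l : ℕ) (s : ℝ) :
    (fun n => override j l y s (j', n)) = fun n => y (j', n) := by
  funext n
  simp [override, hj]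

lemma switchTime_override_of_le {j : Fin 2} {l m : ℕ} (hm : m ≤ l) (s : ℝ) :
    switchTime (fun n => override j l y s (j, n)) m = switchTime (fun n => y (j, n)) m := by
  refine Finset.sum_congr rfl fun k hk => ?_
  have : ¬ l ≤ k := by have := Finset.mem_range.1 hk; omega
  simp [override, this]

lemma switchTime_override_add (j : Fin 2) (l k : ℕ) (s : ℝ) :
    switchTime (fun n => override j l y s (j, n)) (k + l) =
      switchTime (fun n => y (j, n)) l + k * s := by
  induction k with
  | zero => rw [zero_add, switchTime_override_of_le le_rfl]; simp
  | succ k ih =>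
    rw [Nat.add_right_comm, switchTime_succ, ih]
    have : override j l y s (j, k + l) = s := by simp [override]
    simp only [this]
    push_cast
    ring

lemma isNice_override (h : IsNice y) (j : Fin 2) (l : ℕ) {s : ℝ} (hs : 0 < s) :
    IsNice (override j l y s) := by
  intro j'
  by_cases hj : j' = j
  · subst hj
    refine ⟨fun n => ?_, ?_⟩
    · simp only [override]
      split_ifs
      exacts [hs, (h j').pos n]
    · rw [← tendsto_add_atTop_iff_nat l]
      simp only [switchTime_override_add]
      exact tendsto_atTop_add_const_left _ _
        (tendsto_natCast_atTop_atTop.atTop_mul_const hs)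
  · rw [override_of_ne hj]
    exact h j'

/-- Until the end of the `l`-th holding time of walker `j` nothing changes if this walker is kept
from reversing, except that at the very end its direction is still the one of that holding time. -/
lemma gainRate_override (h : IsNice y) (φ : ℝ → ℝ → ℝ → ℝ) (j : Fin 2) (l : ℕ) {s t : ℝ}
    (hs0 : 0 < s) (hs : s ≤ y (j, l)) (ht : t = switchTime (fun n => y (j, n)) l + s) :
    S.gainRate φ (override j l y (s + 1)) j t = S.flipGain φ y (S.carrier y t) t
      (Function.update (fun i => S.dir y i t) j ((S.phaseDir j l : ℤ) : ℝ)) j := by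
  set y' := override j l y (s + 1) with hy'
  have h' : IsNice y' := isNice_override h j l (by linarith)
  have hTl := (h j).switchTime_nonneg l
  have ht0 : 0 ≤ t := by linarith
  have hT' : t < switchTime (fun n => y' (j, n)) (l + 1) := by
    rw [add_comm l, switchTime_override_add]
    push_cast
    linarith
  have hT : t ≤ switchTime (fun n => y (j, n)) (l + 1) := by
    rw [switchTime_succ]
    linarith
  have hother : ∀ i, i ≠ j → ∀ u, S.unitDir y' i u = S.unitDir y i u := fun i hi u => by
    simp only [unitDir, hy', override_of_ne hi]
  have hdir : ∀ i u, 0 ≤ u → u < t → S.unitDir y' i u = S.unitDir y i u := by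
    intro i u hu0 hut
    by_cases hi : i = j
    · subst hi
      obtain ⟨m, hm1, hm2⟩ := (h i).exists_mem_Ico hu0
      have hml : m ≤ l := by
        have : m < l + 1 := (h i).strictMono.lt_iff_lt.1 (hm1.trans_lt (hut.trans_le hT))
        omega
      have hnum : numSwitches (fun n => y' (i, n)) u = m := by
        refine (h' i).numSwitches_of_mem ?_ ?_
        · rwa [switchTime_override_of_le hml]
        · rcases hml.lt_or_eq with hml | rfl
          · rwa [switchTime_override_of_le (Nat.succ_le_iff.2 hml)]
          · exact hut.trans hT'
      simp only [unitDir, direction, hnum, (h i).numSwitches_of_mem hm1 hm2]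
    · exact hother i hi u
  have hlift : ∀ i u, 0 ≤ u → u ≤ t → S.lift y' i u = S.lift y i u := by
    intro i u hu0 hut
    rw [lift, lift, intervalIntegral.integral_congr_ae]
    filter_upwards [Measure.ae_ne volume u] with w hw hmem
    rw [uIoc_of_le hu0] at hmem
    simp only [dir, hdir i w hmem.1.le ((hmem.2.lt_of_ne hw).trans_le hut)]
  have hgap : ∀ k u, 0 ≤ u → u ≤ t → S.gap y' k u = S.gap y k u := fun k u hu0 hut => by
    simp only [gap, sep, hlift _ u hu0 hut]
  have hcar : S.carrier y' t = S.carrier y t := by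
    rw [carrier_eq h, carrier_eq h']
    refine carrierBefore_congr fun u hu0 hut k => ?_
    rw [handoff_iff, handoff_iff, hgap k u hu0 hut.le, hdir _ u hu0 hut, hdir _ u hu0 hut]
  have hself : S.unitDir y' j t = S.phaseDir j l := by
    have hnum : numSwitches (fun n => y' (j, n)) t = l :=
      (h' j).numSwitches_of_mem (by rw [switchTime_override_of_le le_rfl]; linarith) hT'
    simp only [unitDir, direction, hnum, phaseDir]
  have hvec : (fun i => S.dir y' i t) =
      Function.update (fun i => S.dir y i t) j ((S.phaseDir j l : ℤ) : ℝ) := by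
    funext i
    by_cases hi : i = j
    · subst hi
      simp [dir, hself]
    · simp [Function.update_of_ne hi, dir, hother i hi]
  rw [gainRate, hcar, hvec, flipGain, flipGain, obs, obs, obs, obs, hgap _ t ht0 le_rfl]

lemma gainRate_override_of_lt (h : IsNice y) (φ : ℝ → ℝ → ℝ → ℝ) (j : Fin 2) (l : ℕ) {s : ℝ}
    (hs0 : 0 < s) (hs : s < y (j, l)) :
    S.gainRate φ (override j l y (s + 1)) j (switchTime (fun n => y (j, n)) l + s) =
      S.gainRate φ y j (switchTime (fun n => y (j, n)) l + s) := by
  rw [gainRate_override h φ j l hs0 hs.le rfl, gainRate]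
  congr 1
  have hnum := (h j).numSwitches_of_mem (m := l) (t := switchTime (fun n => y (j, n)) l + s)
    (by linarith) (by rw [switchTime_succ]; linarith)
  refine Function.update_eq_self_iff.2 ?_
  simp only [dir, unitDir, direction, phaseDir, hnum]

lemma gainRate_override_self (h : IsNice y) (φ : ℝ → ℝ → ℝ → ℝ) (j : Fin 2) (l : ℕ) :
    S.gainRate φ (override j l y (y (j, l) + 1)) j
      (switchTime (fun n => y (j, n)) l + y (j, l)) = S.reversalGain φ y j l := by
  have e : switchTime (fun n => y (j, n)) (l + 1) =
    switchTime (fun n => y (j, n)) l + y (j, l) := switchTime_succ _ _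
  rw [← e]
  exact gainRate_override h φ j l ((h j).pos l) le_rfl e

lemma integral_gainRate_override (h : IsNice y) (φ : ℝ → ℝ → ℝ → ℝ) (j : Fin 2) (l : ℕ) :
    ∫ s in (0 : ℝ)..y (j, l), S.gainRate φ (override j l y (s + 1)) j
        (switchTime (fun n => y (j, n)) l + s) =
      ∫ u in switchTime (fun n => y (j, n)) l..switchTime (fun n => y (j, n)) (l + 1),
        S.gainRate φ y j u := by
  rw [switchTime_succ, ← add_zero (switchTime (fun n => y (j, n)) l), add_assoc, zero_add,
    ← intervalIntegral.integral_comp_add_left, add_zero]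
  refine intervalIntegral.integral_congr_ae ?_
  filter_upwards [Measure.ae_ne volume (y (j, l))] with s hs hmem
  rw [uIoc_of_le ((h j).pos l).le] at hmem
  exact gainRate_override_of_lt h φ j l hmem.1 (hmem.2.lt_of_ne hs)

/-- Almost surely, up to time `t` the reversals of walker `j` change an observable in total by
`r` times the integral of the change that a reversal would cause, up to an error `o(t)`. -/
theorem ae_tendsto_reversalGain {Ω : Type*} [MeasurableSpace Ω] {P : Measure Ω}
    [IsProbabilityMeasure P] {Y : Ω → Fin 2 × ℕ → ℝ} (hY : Measurable Y)
    (hindep : iIndepFun (fun p ω => Y ω p) P) {r : ℝ} (hr : 0 < r)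
    (hlaw : ∀ p, P.map (fun ω => Y ω p) = expMeasure r)
    (hφ : Continuous fun p : ℝ × ℝ × ℝ => φ p.1 p.2.1 p.2.2) (j : Fin 2) :
    ∀ᵐ ω ∂P, IsNice (Y ω) → Tendsto (fun t : ℝ =>
      (∑ l ∈ Finset.range (numSwitches (fun n => Y ω (j, n)) t), S.reversalGain φ (Y ω) j l -
        ∫ u in (0 : ℝ)..t, r * S.gainRate φ (Y ω) j u) / t) atTop (𝓝 0) := by
  obtain ⟨C, hC⟩ := exists_bound_of_continuous hφ S.N
  set g : ℕ → (Fin 2 × ℕ → ℝ) → ℝ → ℝ := fun l y s =>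
    S.gainRate φ (override j l y (s + 1)) j (switchTime (fun n => y (j, n)) l + s) with hg
  have hgm : ∀ l, Measurable (Function.uncurry (g l)) := by
    intro l
    have h1 : Measurable fun q : (Fin 2 × ℕ → ℝ) × ℝ => override j l q.1 (q.2 + 1) := by
      have := (measurable_override j l).comp
        (measurable_fst.prodMk (measurable_snd.add_const (1 : ℝ)))
      exact this
    have h2 : Measurable fun q : (Fin 2 × ℕ → ℝ) × ℝ =>
        switchTime (fun n => q.1 (j, n)) l + q.2 :=
      (Finset.measurable_sum _ fun k _ =>
        (measurable_pi_apply (j, k)).comp measurable_fst).add measurable_snd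
    have h3 := (measurable_gainRate (S := S) hφ j).comp (h1.prodMk h2)
    exact h3
  have hpast : ∀ l y s, g l (override j l y 0) s = g l y s := fun l y s => by
    simp only [hg, override_override le_rfl, switchTime_override_of_le le_rfl]
  filter_upwards [ae_tendsto_reward hY hindep hr hlaw j hgm
    (fun l y s => abs_gainRate_le hC j _) hpast, ae_tendsto_holding hY hindep hr hlaw j]
    with ω h1 h2 hnice
  have hm : Measurable fun u => r * S.gainRate φ (Y ω) j u := by
    have hp : Measurable fun t : ℝ => (Y ω, t) := measurable_prodMk_left
    have := ((measurable_gainRate (S := S) hφ j).comp hp).const_mul r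
    exact this
  refine (hnice j).tendsto_reward_div hr h2 hm (C := r * (C + C)) (fun u => ?_)
    (h1.congr fun n => ?_)
  · rw [abs_mul, abs_of_pos hr]
    exact mul_le_mul_of_nonneg_left (abs_gainRate_le hC j u) hr.le
  · congr 1
    refine Finset.sum_congr rfl fun l _ => ?_
    simp only [hg]
    rw [gainRate_override_self hnice, integral_gainRate_override hnice,
      intervalIntegral.integral_const_mul]

end TwoWalkers

/-! ### The change of an observable along a path -/

namespace TwoWalkers

variable {S : TwoWalkers} {φ φ' : ℝ → ℝ → ℝ → ℝ} {β : ℝ} {y : Fin 2 × ℕ → ℝ} {I : ℝ → Fin 2}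

lemma carrier_right (h : IsNice y) (hI : IsCarrierPath (S.pos y) (S.unitDir y) S.carrier₀ I)
    {t : ℝ} (ht : 0 ≤ t) : ∀ᶠ s in 𝓝[>] t, I s = I t ∧ S.carrier y s = I t := by
  have hiso := isolatedHandoffs (S := S) h
  filter_upwards [hI.right_cont t ht, hiso.right t ht, self_mem_nhdsWithin] with s h1 h2 h3
  refine ⟨h1, ?_⟩
  rw [← h1, hI.eq_transmit hiso (ht.trans (le_of_lt h3)), transmit_of_not_handoff (h2 _),
    carrier_eq h]

/-- The gap of `k` varies linearly after time `t`, unless it sets out from `0` downwards. -/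
lemma gap_right (h : IsNice y) (k : Fin 2) {t : ℝ} (ht : 0 ≤ t)
    (hk : ¬ Handoff (S.pos y) (S.unitDir y) k t) :
    ∀ᶠ s in 𝓝[>] t, S.gap y k s =
      S.gap y k t + S.v * (S.dir y k t - S.dir y k.rev t) * (s - t) := by
  have key : ∀ᶠ s in 𝓝[>] t, S.N * Int.fract ((S.sep y k t +
      S.v * (S.dir y k t - S.dir y k.rev t) * (s - t)) / S.N) =
      S.N * Int.fract (S.sep y k t / S.N) + S.v * (S.dir y k t - S.dir y k.rev t) * (s - t) := by
    rcases le_or_gt 0 (S.dir y k t - S.dir y k.rev t) with hd | hd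
    · refine mul_fract_affine_of_nonneg S.hN nhdsWithin_le_nhds ?_
      filter_upwards [self_mem_nhdsWithin] with s hs
      exact mul_nonneg (mul_nonneg S.hv.le hd) (sub_nonneg.2 (le_of_lt hs))
    · refine mul_fract_affine_of_ne_zero S.hN nhdsWithin_le_nhds fun h0 => hk ?_
      refine (handoff_iff k t).2 ⟨h0, ?_⟩
      rcases Int.units_eq_one_or (S.unitDir y k t) with h1 | h1 <;>
      rcases Int.units_eq_one_or (S.unitDir y k.rev t) with h2 | h2 <;>
      (simp [dir, h1, h2] at hd ⊢; try norm_num at hd)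
  filter_upwards [key, sep_right (S := S) h k ht] with s h1 h2
  rw [gap, h2, h1, gap]

lemma eventually_Ici_of_Ioi {p : ℝ → Prop} {t : ℝ} (h : ∀ᶠ s in 𝓝[>] t, p s) (ht : p t) :
    ∀ᶠ s in 𝓝[≥] t, p s := by
  rw [← Ioi_insert, eventually_nhdsWithin_iff]
  rw [eventually_nhdsWithin_iff] at h
  filter_upwards [h] with s hs hmem
  rcases hmem with rfl | hmem
  exacts [ht, hs hmem]

/-- After time `t` the observable follows its drift: the carrier at time `t` does not meet the
condition for a handoff, so neither does its gap jump from `0` to `N`. -/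
lemma hasDerivWithinAt_obs (h : IsNice y) (hφ : IsObservable S.N φ φ' β)
    (hI : IsCarrierPath (S.pos y) (S.unitDir y) S.carrier₀ I) {t : ℝ} (ht : 0 ≤ t) :
    HasDerivWithinAt (fun s => S.obs φ y (I s) s (fun j => S.dir y j s))
      (S.obs φ' y (I t) t (fun j => S.dir y j t) *
        (S.v * (S.dir y (I t) t - S.dir y (I t).rev t))) (Ici t) t := by
  have hiso := isolatedHandoffs (S := S) h
  have hno : ¬ Handoff (S.pos y) (S.unitDir y) (I t) t := by
    rw [hI.eq_transmit hiso ht]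
    exact not_handoff_transmit _ _
  set c := S.v * (S.dir y (I t) t - S.dir y (I t).rev t) with hc
  have h1 : HasDerivAt (fun s => S.gap y (I t) t + c * (s - t)) c t := by
    simpa using (((hasDerivAt_id t).sub_const t).const_mul c).const_add (S.gap y (I t) t)
  have h2 := hφ.deriv (S.gap y (I t) t + c * (t - t)) (S.dir y (I t) t) (S.dir y (I t).rev t)
  have h3 := (h2.comp t h1).hasDerivWithinAt (s := Ici t)
  simp only [sub_self, mul_zero, add_zero] at h3
  refine h3.congr_of_eventuallyEq ?_ (by simp [obs])
  refine eventually_Ici_of_Ioi ?_ (by simp [obs])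
  filter_upwards [hI.right_cont t ht, gap_right (S := S) h (I t) ht hno,
    unitDir_right (S := S) h ht] with s e1 e2 e3
  simp only [obs, dir, e1, e2, e3, Function.comp_apply]
  rfl

lemma tendsto_drift_right (h : IsNice y) (hφ : IsObservable S.N φ φ' β)
    (hI : IsCarrierPath (S.pos y) (S.unitDir y) S.carrier₀ I) {t : ℝ} (ht : 0 ≤ t) :
    Tendsto (S.drift φ' y) (𝓝[>] t) (𝓝 (S.obs φ' y (I t) t (fun j => S.dir y j t) *
        (S.v * (S.dir y (I t) t - S.dir y (I t).rev t)))) := by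
  have hiso := isolatedHandoffs (S := S) h
  have hno : ¬ Handoff (S.pos y) (S.unitDir y) (I t) t := by
    rw [hI.eq_transmit hiso ht]
    exact not_handoff_transmit _ _
  set c := S.v * (S.dir y (I t) t - S.dir y (I t).rev t) with hc
  have hcont : Continuous fun s : ℝ =>
      φ' (S.gap y (I t) t + c * (s - t)) (S.dir y (I t) t) (S.dir y (I t).rev t) * c :=
    (hφ.cont'.comp (f := fun s : ℝ =>
      (S.gap y (I t) t + c * (s - t), S.dir y (I t) t, S.dir y (I t).rev t)) (by fun_prop)).mul
      continuous_const
  have h1 := (hcont.tendsto t).mono_left (nhdsWithin_le_nhds (s := Ioi t))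
  simp only [sub_self, mul_zero, add_zero] at h1
  refine h1.congr' ?_
  filter_upwards [carrier_right (S := S) h hI ht, gap_right (S := S) h (I t) ht hno,
    unitDir_right (S := S) h ht] with s e1 e2 e3
  simp only [drift, dir, e1.2, e2, e3, hc]

lemma intervalIntegrable_drift (hφ : IsObservable S.N φ φ' β) (a b : ℝ) :
    IntervalIntegrable (S.drift φ' y) volume a b := by
  obtain ⟨C, hC⟩ := exists_bound_of_continuous hφ.cont' S.N
  have hp : Measurable fun t : ℝ => (y, t) := measurable_prodMk_left
  have hm := (measurable_drift (S := S) hφ.cont').comp hp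
  exact intervalIntegrable_of_bounded hm (fun s => abs_drift_le hC s) a b

/-- The limit of the observable from the left: the gap may wrap around the circle or come to `0`,
but neither shows in `φ` before the directions or the carrier change. -/
lemma tendsto_obs_left (h : IsNice y) (hφ : IsObservable S.N φ φ' β)
    (hI : IsCarrierPath (S.pos y) (S.unitDir y) S.carrier₀ I) {t : ℝ} (ht : 0 < t) {m : Fin 2 → ℕ}
    (hm : ∀ j, switchTime (fun n => y (j, n)) (m j) < t ∧
      t ≤ switchTime (fun n => y (j, n)) (m j + 1)) :
    Tendsto (fun s => S.obs φ y (I s) s (fun j => S.dir y j s)) (𝓝[<] t)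
      (𝓝 (S.obs φ y (S.carrier y t) t fun j => ((S.phaseDir j (m j) : ℤ) : ℝ))) := by
  have hiso := isolatedHandoffs (S := S) h
  set k := S.carrier y t with hk
  set a : ℝ := ((S.phaseDir k (m k) : ℤ) : ℝ) with ha
  set b : ℝ := ((S.phaseDir k.rev (m k.rev) : ℤ) : ℝ) with hb
  have hcont : ∀ q : ℝ, Tendsto (fun s : ℝ => φ (q + S.v * (a - b) * (s - t)) a b) (𝓝[<] t)
      (𝓝 (φ q a b)) := fun q => by
    have : Continuous fun s : ℝ => φ (q + S.v * (a - b) * (s - t)) a b :=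
      hφ.cont.comp (f := fun s : ℝ => (q + S.v * (a - b) * (s - t), a, b)) (by fun_prop)
    simpa using (this.tendsto t).mono_left nhdsWithin_le_nhds
  have hIk := hI.eventually_left hiso ht
  rw [← carrier_eq h, ← hk] at hIk
  have hform : ∀ᶠ s in 𝓝[<] t, S.obs φ y (I s) s (fun j => S.dir y j s) =
      φ (S.N * Int.fract ((S.sep y k t + S.v * (a - b) * (s - t)) / S.N)) a b := by
    filter_upwards [hIk, unitDir_left (S := S) h hm, sep_left (S := S) h k hm] with s e1 e2 e3
    simp only [obs, dir, e1, e2, gap, e3, ha, hb]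
  rw [tendsto_congr' hform]
  have hgap : S.obs φ y k t (fun j => ((S.phaseDir j (m j) : ℤ) : ℝ)) =
    φ (S.N * Int.fract (S.sep y k t / S.N)) a b := rfl
  rw [hgap]
  rcases le_or_gt (a - b) 0 with hd | hd
  · refine (hcont _).congr' ?_
    filter_upwards [mul_fract_affine_of_nonneg (N := S.N) (q := S.sep y k t)
      (c := S.v * (a - b)) S.hN (l := 𝓝[<] t) nhdsWithin_le_nhds (by
        filter_upwards [self_mem_nhdsWithin] with s hs
        exact mul_nonneg_of_nonpos_of_nonpos (mul_nonpos_of_nonneg_of_nonpos S.hv.le hd)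
          (sub_nonpos.2 (le_of_lt hs)))] with s hs
    rw [hs]
  by_cases hq : S.N * Int.fract (S.sep y k t / S.N) = 0
  · -- the gap wraps around the circle: it tends to `N` from the left but is `0` at time `t`
    have hab : a = 1 ∧ b = -1 := by
      rcases Int.units_eq_one_or (S.phaseDir k (m k)) with h1 | h1 <;>
      rcases Int.units_eq_one_or (S.phaseDir k.rev (m k.rev)) with h2 | h2 <;>
      (simp [ha, hb, h1, h2] at hd ⊢; try norm_num at hd)
    have e : φ (S.N * Int.fract (S.sep y k t / S.N)) a b = φ S.N a b := by
      rw [hq, hab.1, hab.2, hφ.wrap]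
    rw [e]
    refine (hcont _).congr' ?_
    filter_upwards [mul_fract_affine_of_neg (N := S.N) (q := S.sep y k t)
      (c := S.v * (a - b)) S.hN (l := 𝓝[<] t) nhdsWithin_le_nhds hq (by
        filter_upwards [self_mem_nhdsWithin] with s hs
        exact mul_neg_of_pos_of_neg (mul_pos S.hv hd) (sub_neg.2 hs))] with s hs
    rw [hs]
  · refine (hcont _).congr' ?_
    filter_upwards [mul_fract_affine_of_ne_zero (N := S.N) (q := S.sep y k t)
      (c := S.v * (a - b)) S.hN (l := 𝓝[<] t) nhdsWithin_le_nhds hq] with s hs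
    rw [hs]

/-- The effect of a handoff at time `t`, which happens when the carrier's gap is `0`. -/
lemma obs_carrier_eq (h : IsNice y) (hφ : IsObservable S.N φ φ' β)
    (hI : IsCarrierPath (S.pos y) (S.unitDir y) S.carrier₀ I) {t : ℝ} (ht : 0 ≤ t) :
    S.obs φ y (I t) t (fun j => S.dir y j t) = S.obs φ y (S.carrier y t) t (fun j => S.dir y j t) +
      β * (if I t = S.carrier y t then 0 else 1) := by
  have hiso := isolatedHandoffs (S := S) h
  have e := hI.eq_transmit hiso ht
  rw [← carrier_eq h] at e
  set k := S.carrier y t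
  by_cases hH : Handoff (S.pos y) (S.unitDir y) k t
  · rw [transmit_of_handoff hH] at e
    have hH' := (handoff_iff k t).1 hH
    have hfr : Int.fract (S.sep y k t / S.N) = 0 := (mul_eq_zero.1 hH'.1).resolve_left S.hN.ne'
    have hgap : S.gap y k.rev t = 0 := by
      have hsep : S.sep y k.rev t = -S.sep y k t := by
        simp only [sep, Fin.rev_rev]
        ring
      rw [gap, hsep, neg_div, Int.fract_neg_eq_zero.2 hfr, mul_zero]
    rw [if_neg (by rw [e]; exact Fin.rev_ne_self k), e]
    simp only [obs, Fin.rev_rev, hgap, hH'.1, dir, hH'.2.1, hH'.2.2]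
    simpa using hφ.handoff
  · rw [transmit_of_not_handoff hH] at e
    simp [e]

/-- At time `t` either walker `j` does not reverse, or its `m`-th holding time ends. -/
lemma numSwitches_cases (h : IsNice y) (j : Fin 2) {t : ℝ} {m : ℕ}
    (hm : switchTime (fun n => y (j, n)) m < t ∧ t ≤ switchTime (fun n => y (j, n)) (m + 1)) :
    (numSwitches (fun n => y (j, n)) t = m ∧ S.dir y j t = ((S.phaseDir j m : ℤ) : ℝ)) ∨
    (t = switchTime (fun n => y (j, n)) (m + 1) ∧ numSwitches (fun n => y (j, n)) t = m + 1 ∧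
      S.dir y j t = -((S.phaseDir j m : ℤ) : ℝ)) := by
  rcases hm.2.lt_or_eq with hlt | heq
  · have hnum := (h j).numSwitches_of_mem hm.1.le hlt
    exact Or.inl ⟨hnum, by simp only [dir, unitDir, direction, hnum, phaseDir]⟩
  · have hnum : numSwitches (fun n => y (j, n)) t = m + 1 := by
      rw [heq]
      exact (h j).numSwitches_switchTime (m + 1)
    refine Or.inr ⟨heq, hnum, ?_⟩
    simp [dir, unitDir, direction, hnum, phaseDir, pow_succ]

/-- The effect of the reversals at time `t`, when the walkers do not reverse simultaneously. -/
lemma obs_sub_obs_phaseDir (h : IsNice y)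
    (hdisj : ∀ l l', switchTime (fun n => y (0, n)) (l + 1) ≠
      switchTime (fun n => y (1, n)) (l' + 1))
    (φ : ℝ → ℝ → ℝ → ℝ) {t : ℝ} {m : Fin 2 → ℕ}
    (hm : ∀ j, switchTime (fun n => y (j, n)) (m j) < t ∧
      t ≤ switchTime (fun n => y (j, n)) (m j + 1)) :
    S.obs φ y (S.carrier y t) t (fun j => S.dir y j t) =
      S.obs φ y (S.carrier y t) t (fun j => ((S.phaseDir j (m j) : ℤ) : ℝ)) +
      ∑ j, (∑ l ∈ Finset.range (numSwitches (fun n => y (j, n)) t), S.reversalGain φ y j l -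
        ∑ l ∈ Finset.range (m j), S.reversalGain φ y j l) := by
  -- `one j` treats the case that only walker `j` reverses at time `t`
  have one : ∀ j : Fin 2, t = switchTime (fun n => y (j, n)) (m j + 1) →
      numSwitches (fun n => y (j, n)) t = m j + 1 →
      S.dir y j t = -((S.phaseDir j (m j) : ℤ) : ℝ) →
      numSwitches (fun n => y (j.rev, n)) t = m j.rev →
      S.dir y j.rev t = ((S.phaseDir j.rev (m j.rev) : ℤ) : ℝ) →
      S.obs φ y (S.carrier y t) t (fun j => S.dir y j t) =
      S.obs φ y (S.carrier y t) t (fun j => ((S.phaseDir j (m j) : ℤ) : ℝ)) +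
      ∑ j, (∑ l ∈ Finset.range (numSwitches (fun n => y (j, n)) t), S.reversalGain φ y j l -
        ∑ l ∈ Finset.range (m j), S.reversalGain φ y j l) := by
    intro j ht hn hd hn' hd'
    rw [Fin.sum_eq_add_rev _ j, hn, hn', sub_self, add_zero, Finset.sum_range_succ,
      add_sub_cancel_left, reversalGain, ← ht, flipGain]
    have e1 : Function.update (fun i => S.dir y i t) j ((S.phaseDir j (m j) : ℤ) : ℝ) =
        fun i => ((S.phaseDir i (m i) : ℤ) : ℝ) := by
      funext i
      rcases Fin.eq_or_eq_rev j i with rfl | rfl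
      · simp
      · rw [Function.update_of_ne (Fin.rev_ne_self j), hd']
    have e2 : Function.update (fun i => ((S.phaseDir i (m i) : ℤ) : ℝ)) j
        (-((S.phaseDir j (m j) : ℤ) : ℝ)) = fun i => S.dir y i t := by
      funext i
      rcases Fin.eq_or_eq_rev j i with rfl | rfl
      · simp [hd]
      · rw [Function.update_of_ne (Fin.rev_ne_self j), hd']
    simp only [e1, e2]
    ring
  rcases numSwitches_cases (S := S) h 0 (hm 0) with ⟨n0, d0⟩ | ⟨t0, n0, d0⟩ <;>
  rcases numSwitches_cases (S := S) h 1 (hm 1) with ⟨n1, d1⟩ | ⟨t1, n1, d1⟩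
  · have e : (fun j => S.dir y j t) = fun j => ((S.phaseDir j (m j) : ℤ) : ℝ) := by
      funext j
      rcases Fin.eq_or_eq_rev 0 j with rfl | rfl
      exacts [d0, d1]
    simp [e, Fin.sum_univ_two, n0, n1]
  · exact one 1 t1 n1 d1 n0 d0
  · exact one 0 t0 n0 d0 n1 d1
  · exact absurd (t0.symm.trans t1) (hdisj _ _)

/-- Pathwise balance of an observable: its change up to time `t` is the contribution `β` of each
handoff, plus the accumulated drift, plus the changes caused by the reversals of the walkers. -/
theorem obs_sub_obs_zero (h : IsNice y)
    (hdisj : ∀ l l', switchTime (fun n => y (0, n)) (l + 1) ≠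
      switchTime (fun n => y (1, n)) (l' + 1))
    (hφ : IsObservable S.N φ φ' β)
    (hI : IsCarrierPath (S.pos y) (S.unitDir y) S.carrier₀ I) {t : ℝ} (ht : 0 ≤ t) :
    S.obs φ y (I t) t (fun j => S.dir y j t) - S.obs φ y (I 0) 0 (fun j => S.dir y j 0) =
      β * (jumpTimes I t).ncard + (∫ u in (0 : ℝ)..t, S.drift φ' y u) +
      ∑ j, ∑ l ∈ Finset.range (numSwitches (fun n => y (j, n)) t), S.reversalGain φ y j l := by
  have hiso := isolatedHandoffs (S := S) h
  -- the difference of the two sides is continuous with right derivative `0`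
  set Φ : ℝ → ℝ := fun s => S.obs φ y (I s) s (fun j => S.dir y j s) -
    (∫ u in (0 : ℝ)..s, S.drift φ' y u) - (β * (jumpTimes I s).ncard +
    ∑ j, ∑ l ∈ Finset.range (numSwitches (fun n => y (j, n)) s), S.reversalGain φ y j l) with hΦ
  have hp : Measurable fun t : ℝ => (y, t) := measurable_prodMk_left
  have hmd : Measurable (S.drift φ' y) := by
    have := (measurable_drift (S := S) hφ.cont').comp hp
    exact this
  have hderiv : ∀ s, 0 ≤ s → HasDerivWithinAt Φ 0 (Ici s) s := by
    intro s hs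
    have h1 := hasDerivWithinAt_obs (S := S) h hφ hI hs
    have h2 := intervalIntegral.integral_hasDerivWithinAt_of_tendsto_ae_right (s := Ici s)
      (t := Ioi s) (intervalIntegrable_drift (S := S) (y := y) hφ 0 s)
      (hmd.stronglyMeasurable.stronglyMeasurableAtFilter)
      ((tendsto_drift_right (S := S) h hφ hI hs).mono_left inf_le_left)
    have h3 : HasDerivWithinAt (fun s => β * ((jumpTimes I s).ncard : ℝ) +
        ∑ j, ∑ l ∈ Finset.range (numSwitches (fun n => y (j, n)) s), S.reversalGain φ y j l) 0
        (Ici s) s := by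
      refine (hasDerivWithinAt_const s (Ici s) _).congr_of_eventuallyEq ?_ rfl
      refine eventually_Ici_of_Ioi ?_ rfl
      filter_upwards [hI.jumpTimes_right hs, eventually_all.2 fun j => (h j).eventually_right hs]
        with u e1 e2
      simp only [e1, e2]
    have h4 := (h1.sub h2).sub h3
    rw [sub_self, sub_zero] at h4
    exact h4
  have hleft : ∀ s, 0 < s → ContinuousWithinAt Φ (Iio s) s := by
    intro s hs
    obtain ⟨m, hm⟩ := exists_phase h hs
    have h1 := tendsto_obs_left (S := S) h hφ hI hs hm
    have h2 : Tendsto (fun w => ∫ u in (0 : ℝ)..w, S.drift φ' y u) (𝓝[<] s)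
        (𝓝 (∫ u in (0 : ℝ)..s, S.drift φ' y u)) :=
      ((intervalIntegral.continuous_primitive
        (fun a b => intervalIntegrable_drift (S := S) (y := y) hφ a b) 0).tendsto s).mono_left
        nhdsWithin_le_nhds
    have hIk := hI.eventually_left hiso hs
    rw [← carrier_eq h] at hIk
    have h3 : Tendsto (fun w => β * ((jumpTimes I w).ncard : ℝ) +
        ∑ j, ∑ l ∈ Finset.range (numSwitches (fun n => y (j, n)) w), S.reversalGain φ y j l)
        (𝓝[<] s) (𝓝 (β * ((jumpTimes I s).ncard - if I s = S.carrier y s then 0 else 1) +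
        ∑ j, ∑ l ∈ Finset.range (m j), S.reversalGain φ y j l)) := by
      refine tendsto_const_nhds.congr' ?_
      filter_upwards [hI.ncard_jumpTimes_left hs hIk,
        eventually_all.2 fun j => (h j).eventually_left (hm j).1 (hm j).2] with w e1 e2
      rw [e1]
      simp only [e2]
    have h4 := (h1.sub h2).sub h3
    have e : Φ s = S.obs φ y (S.carrier y s) s (fun j => ((S.phaseDir j (m j) : ℤ) : ℝ)) -
        (∫ u in (0 : ℝ)..s, S.drift φ' y u) -
        (β * ((jumpTimes I s).ncard - if I s = S.carrier y s then 0 else 1) +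
        ∑ j, ∑ l ∈ Finset.range (m j), S.reversalGain φ y j l) := by
      simp only [hΦ]
      rw [obs_carrier_eq h hφ hI hs.le, obs_sub_obs_phaseDir h hdisj φ hm, Finset.sum_sub_distrib]
      ring
    rw [ContinuousWithinAt, e]
    exact h4
  have hcont : ContinuousOn Φ (Icc 0 t) := by
    intro s hs
    rcases hs.1.eq_or_lt with rfl | hs0
    · exact (hderiv 0 le_rfl).continuousWithinAt.mono Icc_subset_Ici_self
    · refine ContinuousAt.continuousWithinAt (continuousAt_iff_continuous_left'_right'.2
        ⟨hleft s hs0, ?_⟩)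
      exact (hderiv s hs.1).continuousWithinAt.mono Ioi_subset_Ici_self
  have hconst := constant_of_has_deriv_right_zero hcont (fun s hs => hderiv s hs.1) t
    (right_mem_Icc.2 ht)
  have hj0 : jumpTimes I 0 = ∅ :=
    eq_empty_of_forall_notMem fun s hs => absurd (hs.1.trans_le hs.2.1) (lt_irrefl 0)
  have h0 : Φ 0 = S.obs φ y (I 0) 0 (fun j => S.dir y j 0) := by
    simp [hΦ, hj0, fun j => (h j).numSwitches_zero]
  rw [h0] at hconst
  simp only [hΦ] at hconst
  linarith

end TwoWalkers

/-! ### Long-term averages -/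

namespace TwoWalkers

variable {S : TwoWalkers} {φ φ' : ℝ → ℝ → ℝ → ℝ} {β r : ℝ} {y : Fin 2 × ℕ → ℝ} {I : ℝ → Fin 2}

/-- For both walkers, the changes of the observable `φ` at the reversals agree up to time `t` with
the integral of the expected change per unit of time, up to an error `o(t)`. -/
def Balanced (S : TwoWalkers) (r : ℝ) (φ : ℝ → ℝ → ℝ → ℝ) (y : Fin 2 × ℕ → ℝ) : Prop :=
  ∀ j, Tendsto (fun t : ℝ =>
    (∑ l ∈ Finset.range (numSwitches (fun n => y (j, n)) t), S.reversalGain φ y j l -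
      ∫ u in (0 : ℝ)..t, r * S.gainRate φ y j u) / t) atTop (𝓝 0)

/-- For a bounded observable, the handoffs and the integral of its generator compensate each other
in the long run. -/
lemma tendsto_generator (h : IsNice y)
    (hdisj : ∀ l l', switchTime (fun n => y (0, n)) (l + 1) ≠
      switchTime (fun n => y (1, n)) (l' + 1))
    (hφ : IsObservable S.N φ φ' β) (hbal : S.Balanced r φ y)
    (hI : IsCarrierPath (S.pos y) (S.unitDir y) S.carrier₀ I) :
    Tendsto (fun t : ℝ => (β * (jumpTimes I t).ncard +
      ∫ u in (0 : ℝ)..t, (S.drift φ' y u + ∑ j, r * S.gainRate φ y j u)) / t) atTop (𝓝 0) := by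
  obtain ⟨C, hC⟩ := exists_bound_of_continuous hφ.cont S.N
  have hp : Measurable fun t : ℝ => (y, t) := measurable_prodMk_left
  have hgi : ∀ j a b, IntervalIntegrable (fun u => r * S.gainRate φ y j u) volume a b := by
    intro j a b
    have hm := (measurable_gainRate (S := S) hφ.cont j).comp hp
    exact (intervalIntegrable_of_bounded hm (fun s => abs_gainRate_le hC j s) a b).const_mul r
  have hF : Tendsto (fun t : ℝ => (S.obs φ y (I t) t (fun j => S.dir y j t) -
      S.obs φ y (I 0) 0 (fun j => S.dir y j 0)) / t) atTop (𝓝 0) := by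
    have h0 : Tendsto (fun t : ℝ => (C + C) / t) atTop (𝓝 0) :=
      tendsto_const_nhds.div_atTop tendsto_id
    refine squeeze_zero_norm' ?_ h0
    filter_upwards [eventually_gt_atTop 0] with t ht
    rw [Real.norm_eq_abs, abs_div, abs_of_pos ht]
    refine div_le_div_of_nonneg_right ((abs_sub _ _).trans ?_) ht.le
    exact add_le_add (abs_obs_le hC _ _ fun i => abs_dir i t)
      (abs_obs_le hC _ _ fun i => abs_dir i 0)
  have h1 := hF.sub ((hbal 0).add (hbal 1))
  rw [add_zero, sub_zero] at h1
  refine h1.congr' ?_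
  filter_upwards [eventually_ge_atTop 0] with t ht
  rw [← add_div, ← sub_div, obs_sub_obs_zero h hdisj hφ hI ht]
  simp only [Fin.sum_univ_two]
  rw [intervalIntegral.integral_add (intervalIntegrable_drift hφ 0 t)
    ((hgi 0 0 t).add (hgi 1 0 t)), intervalIntegral.integral_add (hgi 0 0 t) (hgi 1 0 t)]
  congr 1
  ring

lemma sum_gainRate (φ : ℝ → ℝ → ℝ → ℝ) (y : Fin 2 × ℕ → ℝ) (t : ℝ) :
    ∑ j, r * S.gainRate φ y j t =
      r * (φ (S.gap y (S.carrier y t) t) (-S.dir y (S.carrier y t) t)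
          (S.dir y (S.carrier y t).rev t) +
        φ (S.gap y (S.carrier y t) t) (S.dir y (S.carrier y t) t)
          (-S.dir y (S.carrier y t).rev t) -
        2 * φ (S.gap y (S.carrier y t) t) (S.dir y (S.carrier y t) t)
          (S.dir y (S.carrier y t).rev t)) := by
  rw [Fin.sum_eq_add_rev _ (S.carrier y t)]
  simp only [gainRate, flipGain, obs, Function.update_self,
    Function.update_of_ne (Fin.rev_ne_self _), Function.update_of_ne (Fin.rev_ne_self _).symm]
  ring

/-- The limit `r v / (2 v + r N)` of the number of handoffs per unit of time. -/
noncomputable def handoffRate (S : TwoWalkers) (r : ℝ) : ℝ := r * S.v / (2 * S.v + r * S.N)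

/-- The solution of the Poisson equation for the number of handoffs: an observable that increases
by `1` at each handoff and whose generator is the constant `-handoffRate`. -/
noncomputable def handoffPotential (S : TwoWalkers) (r h a b : ℝ) : ℝ :=
  r / (2 * S.v) * (h - S.handoffRate r * h ^ 2 / S.v) +
    (a - b) / 4 * (1 - 2 * S.handoffRate r * h / S.v) + S.handoffRate r / (4 * r) * (a * b)

/-- The derivative of `handoffPotential` in the gap. -/
noncomputable def handoffPotential' (S : TwoWalkers) (r h a b : ℝ) : ℝ :=
  r / (2 * S.v) * (1 - 2 * S.handoffRate r * h / S.v) -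
    (a - b) / 2 * (S.handoffRate r / S.v)

lemma isObservable_handoffPotential (S : TwoWalkers) (hr : 0 < r) :
    IsObservable S.N (S.handoffPotential r) (S.handoffPotential' r) 1 where
  cont := by unfold handoffPotential; fun_prop
  cont' := by unfold handoffPotential'; fun_prop
  deriv h a b := by
    have h1 : HasDerivAt (fun x : ℝ => x - S.handoffRate r * x ^ 2 / S.v)
        (1 - S.handoffRate r * (2 * h) / S.v) h := by
      have := (hasDerivAt_id' h).sub
        (((hasDerivAt_pow 2 h).const_mul (S.handoffRate r)).div_const S.v)
      exact this.congr_deriv (by simp)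
    have h2 : HasDerivAt (fun x : ℝ => 1 - 2 * S.handoffRate r * x / S.v)
        (-(2 * S.handoffRate r / S.v)) h := by
      simpa using (((hasDerivAt_id h).const_mul (2 * S.handoffRate r)).div_const S.v).const_sub 1
    have h3 := ((h1.const_mul (r / (2 * S.v))).add (h2.const_mul ((a - b) / 4))).add_const
      (S.handoffRate r / (4 * r) * (a * b))
    refine h3.congr_deriv ?_
    simp only [handoffPotential']
    ring
  wrap := by
    -- this is the condition that determines the value of `handoffRate`
    have hv := S.hv
    have hN := S.hN
    have : (2 * S.v + r * S.N) ≠ 0 := by positivity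
    have := hv.ne'
    simp only [handoffPotential, handoffRate]
    field_simp
    ring
  handoff := by
    simp only [handoffPotential]
    ring

lemma generator_handoffPotential (S : TwoWalkers) (hr : 0 < r) (y : Fin 2 × ℕ → ℝ) (t : ℝ) :
    S.drift (S.handoffPotential' r) y t + ∑ j, r * S.gainRate (S.handoffPotential r) y j t =
      -S.handoffRate r := by
  have hv := S.hv.ne'
  have hr' := hr.ne'
  rw [sum_gainRate, drift]
  have ha := dir_eq_one_or (S := S) (y := y) (S.carrier y t) t
  have hb := dir_eq_one_or (S := S) (y := y) (S.carrier y t).rev t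
  simp only [handoffPotential, handoffPotential']
  rcases ha with ha | ha <;> rcases hb with hb | hb <;> rw [ha, hb] <;> field_simp <;> ring

/-- The direction of the carrier jumps from `-1` to `1` at each handoff. -/
lemma isObservable_dir (N : ℝ) : IsObservable N (fun _ a _ => a) (fun _ _ _ => 0) 2 where
  cont := by fun_prop
  cont' := by fun_prop
  deriv h a _ := hasDerivAt_const h a
  wrap := rfl
  handoff := by norm_num

theorem tendsto_jumpTimes (hr : 0 < r) (h : IsNice y)
    (hdisj : ∀ l l', switchTime (fun n => y (0, n)) (l + 1) ≠
      switchTime (fun n => y (1, n)) (l' + 1))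
    (hbal : S.Balanced r (S.handoffPotential r) y)
    (hI : IsCarrierPath (S.pos y) (S.unitDir y) S.carrier₀ I) :
    Tendsto (fun t : ℝ => ((jumpTimes I t).ncard : ℝ) / t) atTop (𝓝 (S.handoffRate r)) := by
  have h1 := (tendsto_generator h hdisj (isObservable_handoffPotential S hr) hbal hI).add_const
    (S.handoffRate r)
  rw [zero_add] at h1
  refine h1.congr' ?_
  filter_upwards [eventually_gt_atTop 0] with t ht
  simp only [generator_handoffPotential S hr, intervalIntegral.integral_const, smul_eq_mul]
  field_simp
  ring

/-- The direction of the carrier has generator `-2 r` times itself between handoffs and jumps by `2`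
at each handoff, so its long-term average is `1 / r` times the frequency of the handoffs. -/
theorem tendsto_speed (hr : 0 < r) (h : IsNice y)
    (hdisj : ∀ l l', switchTime (fun n => y (0, n)) (l + 1) ≠
      switchTime (fun n => y (1, n)) (l' + 1))
    (hbal : S.Balanced r (S.handoffPotential r) y) (hbal' : S.Balanced r (fun _ a _ => a) y)
    (hI : IsCarrierPath (S.pos y) (S.unitDir y) S.carrier₀ I) :
    Tendsto (fun t : ℝ => (1 / t) * ∫ u in (0 : ℝ)..t, S.v * S.dir y (I u) u) atTop
      (𝓝 (S.v / r * S.handoffRate r)) := by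
  have h1 := tendsto_generator h hdisj (isObservable_dir S.N) hbal' hI
  have h2 := ((tendsto_jumpTimes hr h hdisj hbal hI).const_mul 2).sub h1
  have h3 := h2.const_mul (S.v / (2 * r))
  have e : S.v / (2 * r) * (2 * S.handoffRate r - 0) = S.v / r * S.handoffRate r := by
    field_simp
    ring
  rw [e] at h3
  refine h3.congr' ?_
  filter_upwards [eventually_gt_atTop 0] with t ht
  have hgen : ∀ u, S.drift (fun _ _ _ => 0) y u + ∑ j, r * S.gainRate (fun _ a _ => a) y j u =
      -(2 * r) * S.dir y (S.carrier y u) u := fun u => by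
    rw [sum_gainRate, drift]
    ring
  have hae : ∫ u in (0 : ℝ)..t, S.v * S.dir y (I u) u =
      ∫ u in (0 : ℝ)..t, S.v * S.dir y (S.carrier y u) u := by
    -- a carrier path differs from its left limits at handoffs only
    refine intervalIntegral.integral_congr_ae ?_
    filter_upwards [(countable_handoff (S := S) h).ae_notMem volume] with u hu hmem
    rw [uIoc_of_le ht.le] at hmem
    have hno : ∀ k, ¬ Handoff (S.pos y) (S.unitDir y) k u := fun k hk => hu ⟨hmem.1.le, k, hk⟩
    rw [hI.eq_transmit (isolatedHandoffs h) hmem.1.le, transmit_of_not_handoff (hno _),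
      carrier_eq h]
  simp only [hgen, hae, intervalIntegral.integral_const_mul]
  field_simp
  ring

end TwoWalkers

/-! ### Almost sure regularity of the holding times -/

section

variable {Ω : Type*} [MeasurableSpace Ω] {P : Measure Ω} {Y : Ω → Fin 2 × ℕ → ℝ} {r : ℝ}

lemma ae_isNice (hY : Measurable Y) (hindep : iIndepFun (fun p ω => Y ω p) P)
    (hr : 0 < r) (hlaw : ∀ p, P.map (fun ω => Y ω p) = expMeasure r) : ∀ᵐ ω ∂P, IsNice (Y ω) := by
  have hpos : ∀ᵐ ω ∂P, ∀ p, 0 < Y ω p := ae_all_iff.2 fun p => by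
    have := ae_pos_expMeasure (r := r)
    rw [← hlaw p] at this
    exact ae_of_ae_map ((measurable_pi_apply p).comp hY).aemeasurable this
  filter_upwards [hpos, ae_all_iff.2 fun j => ae_tendsto_holding hY hindep hr hlaw j] with ω h1 h2 j
  refine ⟨fun n => h1 _, ?_⟩
  refine ((h2 j).pos_mul_atTop (one_div_pos.2 hr) tendsto_natCast_atTop_atTop).congr' ?_
  filter_upwards [eventually_gt_atTop 0] with n hn
  have : (n : ℝ) ≠ 0 := by exact_mod_cast hn.ne'
  rw [div_mul_cancel₀ _ this]
  rfl

/-- Almost surely the two walkers never reverse simultaneously. -/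
lemma ae_switchTime_ne [IsProbabilityMeasure P] (hY : Measurable Y)
    (hindep : iIndepFun (fun p ω => Y ω p) P) (hr : 0 < r)
    (hlaw : ∀ p, P.map (fun ω => Y ω p) = expMeasure r) :
    ∀ᵐ ω ∂P, ∀ l l', switchTime (fun n => Y ω (0, n)) (l + 1) ≠
      switchTime (fun n => Y ω (1, n)) (l' + 1) := by
  refine ae_all_iff.2 fun l => ae_all_iff.2 fun l' => ?_
  have hm : ∀ j n, Measurable fun y : Fin 2 × ℕ → ℝ => switchTime (fun k => y (j, k)) n :=
    fun j n => Finset.measurable_sum _ fun k _ => measurable_pi_apply (j, k)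
  filter_upwards [ae_ne_of_override hY hindep hr hlaw 0 l
    (g := fun y => switchTime (fun n => y (1, n)) (l' + 1) - switchTime (fun n => y (0, n)) l)
    ((hm 1 _).sub (hm 0 l)) fun y => by
      rw [TwoWalkers.switchTime_override_of_le le_rfl, TwoWalkers.override_of_ne (by decide)]]
    with ω hω h
  rw [switchTime_succ] at h
  exact hω (by linarith)

end

theorem theorem3p6 {Ω : Type*} [MeasurableSpace Ω] (P : Measure Ω) [IsProbabilityMeasure P]
    (N v r : ℝ) (hN : 0 < N) (hv : 0 < v) (hr : 0 < r)
    -- the holding times of the two walkers: independent and exponential with rate `r`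
    (τ : Fin 2 → ℕ → Ω → ℝ)
    (hlaw : ∀ j n, HasLaw (τ j n) (expMeasure r) P)
    (hindep : iIndepFun (fun (p : Fin 2 × ℕ) => τ p.1 p.2) P)
    -- the initial state
    (x : Fin 2 → AddCircle N) (d : Fin 2 → ℤˣ) (i : Fin 2) :
    ∃ c s : ℝ, c = r * v / (2 * v + r * N) ∧ c = (r / v) * s ∧
      ∀ᵐ ω ∂P,
        let D : Fin 2 → ℝ → ℤˣ := fun j t => direction (d j) (fun n => τ j n ω) t
        let X : Fin 2 → ℝ → AddCircle N := fun j t => position N v (x j) (d j) (fun n => τ j n ω) t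
        (∃ I : ℝ → Fin 2, IsCarrierPath X D i I) ∧
        ∀ I : ℝ → Fin 2, IsCarrierPath X D i I →
          (∀ t : ℝ, (jumpTimes I t).Finite) ∧
          Tendsto (fun t : ℝ => ((jumpTimes I t).ncard : ℝ) / t) atTop (𝓝 c) ∧
          Tendsto (fun t : ℝ => (1 / t) * ∫ u in (0 : ℝ)..t, v * ((D (I u) u : ℤ) : ℝ))
            atTop (𝓝 s) := by
  choose start hstart using fun j => QuotientAddGroup.mk_surjective (x j)
  obtain rfl : (fun j => (start j : AddCircle N)) = x := funext hstart
  set S : TwoWalkers := ⟨N, v, start, d, i, hN, hv⟩ with hS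
  refine ⟨S.handoffRate r, v / r * S.handoffRate r, rfl, by field_simp, ?_⟩
  -- the holding times are only almost everywhere measurable; `Y` is a measurable version
  have haem : ∀ p : Fin 2 × ℕ, AEMeasurable (τ p.1 p.2) P := fun p => (hlaw p.1 p.2).aemeasurable
  set Y : Ω → Fin 2 × ℕ → ℝ := fun ω p => (haem p).mk _ ω with hYdef
  have hY : Measurable Y := measurable_pi_lambda _ fun p => (haem p).measurable_mk
  have hτY : ∀ᵐ ω ∂P, Y ω = fun p => τ p.1 p.2 ω := by
    filter_upwards [ae_all_iff.2 fun p => (haem p).ae_eq_mk] with ω hω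
    exact funext fun p => (hω p).symm
  have hYindep : iIndepFun (fun p ω => Y ω p) P :=
    (iIndepFun_congr fun p => (haem p).ae_eq_mk).1 hindep
  have hYlaw : ∀ p, P.map (fun ω => Y ω p) = expMeasure r := fun p => by
    rw [← (hlaw p.1 p.2).map_eq]
    exact Measure.map_congr (haem p).ae_eq_mk.symm
  filter_upwards [hτY, ae_isNice hY hYindep hr hYlaw, ae_switchTime_ne hY hYindep hr hYlaw,
    ae_all_iff.2 fun j => TwoWalkers.ae_tendsto_reversalGain (S := S) hY hYindep hr hYlaw
      (TwoWalkers.isObservable_handoffPotential S hr).cont j,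
    ae_all_iff.2 fun j => TwoWalkers.ae_tendsto_reversalGain (S := S) (φ := fun _ a _ => a)
      hY hYindep hr hYlaw (TwoWalkers.isObservable_dir N).cont j] with ω hω hnice hdisj hb1 hb2
  replace hb1 : S.Balanced r (S.handoffPotential r) (Y ω) := fun j => hb1 j hnice
  replace hb2 : S.Balanced r (fun _ a _ => a) (Y ω) := fun j => hb2 j hnice
  rw [hω] at hnice hdisj hb1 hb2
  have hex := (TwoWalkers.isolatedHandoffs (S := S) hnice).isCarrierPath (i := i)
  refine ⟨⟨_, hex⟩, fun I hI => ?_⟩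
  have hI' : IsCarrierPath (S.pos fun p => τ p.1 p.2 ω) (S.unitDir fun p => τ p.1 p.2 ω) i I := hI
  have hjump := TwoWalkers.tendsto_jumpTimes (S := S) hr hnice hdisj hb1 hI'
  have hspeed := TwoWalkers.tendsto_speed (S := S) hr hnice hdisj hb1 hb2 hI'
  exact ⟨hI'.finite_jumpTimes, hjump, hspeed⟩
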